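/- Conventions. $C(Y)$ denotes the continuous complex-valued functions on $Y$; $M_N(\cdot)$ carries its C*-norm; $a\oplus b$ is the block diagonal matrix; $\mathrm{Proj}$ denotes the set of (self-adjoint) projections. A unital C*-algebra has real rank zero if its invertible self-adjoint elements are norm dense in its self-adjoint elements. Condition $D_{\mathcal G}$. For a compact metric space $Y$ and a finite set $\mathcal G\subset C(Y)$, we say that $Y$ satisfies condition $D_{\mathcal G}$ if for every $\varepsilon>0$ there are $\delta>0$ and a positive integer $N$ such that, for every unital C*-algebra $\mathcal B$, every unital $*$-homomorphism $\varphi:C(Y)\to\mathcal B$ and every projection $p\in\mathcal B$ with $\|p\varphi(f)-\varphi(f)p\|<\delta$ for all $f\in\mathcal G$, there are finitely many points $\xi_1,\dots,\xi_m,\lambda_1,\dots,\lambda_r\in Y$, mutually orthogonal projections $p_1,\dots,p_m\in M_N(p\mathcal Bp)$ with $\sum_j p_j=1_{M_N(p\mathcal Bp)}$, and mutually orthogonal projections $q_1,\dots,q_r\in M_{N+1}(p\mathcal Bp)$ with $\sum_l q_l=1_{M_{N+1}(p\mathcal Bp)}$, such that $$\Big\|\,p\varphi(f)p\oplus\sum_{j=1}^m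 f(\xi_j)p_j-\sum_{l=1}^r f(\lambda_l)q_l\Big\|<\varepsilon\qquad\text{for all } f\in\mathcal G .$$ Lemma. Let $X$ be a compact metric space, $x_0\in X$, and let $\{x_0\}=X_0\subset X_1\subset\cdots\subset X_n\subset X$ be closed subsets. Let $\mathcal F\subset C(X)$ be finite, and assume that for each $k=1,\dots,n$ the space $X_k$ satisfies condition $D_{\mathcal F_k}$ with $\mathcal F_k=\{f|_{X_k}: f\in\mathcal F\}$. Then for every $\varepsilon>0$ there is $\delta>0$, depending only on $\varepsilon$, $\mathcal F$ and $\{X_k\}_{k=0}^n$, such that the following holds. Let $A$ be a unital C*-algebra of real rank zero, let $\{0\}=I_n\subset\cdots\subset I_1\subset I_0\subset A$ be closed two-sided ideals of $A$ with quotient maps $\pi_k:A\to A/I_k$, and let $\varphi:C(X)\to A$ be a unital $*$-homomorphism such that, for each $k=1,\dots,n$, $\pi_k(\varphi(g))=0$ for every $g\in C(X)$ with $g|_{X_k}=0$. Let $p\in A$ be a projection with $\pi_0(p)=1$ and $\|[\varphi(f),p]\|<\delta$ for all $f\in\mathcal F$, and put $\bar p=1-p$. Then there are positive integers $N_0,\dots,N_{n-1}$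 and $*$-homomorphisms with finite-dimensional range $h_k:C(X)\to M_{N_k}(I_k)$ $(k=0,\dots,n-1)$ and $H:C(X)\to M_{N_0+\cdots+N_{n-1}+1}(A)$ such that $$\big\|\,\bar p\varphi(f)\bar p\oplus h_0(f)\oplus\cdots\oplus h_{n-1}(f)-H(f)\big\|<\varepsilon\qquad\text{for all } f\in\mathcal F .$$ Moreover, these are of the form $$h_k(f)=\sum_{j=1}^{L_k}f(\xi_{kj})\,p_{kj},\qquad H(f)=\sum_{i=1}^{L}f(\zeta_i)\,q_i\qquad (f\in C(X)),$$ where $\xi_{kj}\in X_{k+1}$, $\zeta_i\in X$, for each $k$ the $p_{kj}\in\mathrm{Proj}(M_{N_k}(I_k))$ are mutually orthogonal, the $q_i\in\mathrm{Proj}(M_{N_0+\cdots+N_{n-1}+1}(A))$ are mutually orthogonal, and $$\bar p\oplus\sum_{j=1}^{L_0}p_{0j}\oplus\cdots\oplus\sum_{j=1}^{L_{n-1}}p_{n-1,j}=\sum_{i=1}^{L}q_i .$$ -/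

import Mathlib

universe u v

/-- A unital C⋆-algebra has real rank zero if its invertible self-adjoint elements are
dense in its self-adjoint elements. -/
def HasRealRankZero (A : Type*) [CStarAlgebra A] : Prop :=
  ∀ a : A, IsSelfAdjoint a → a ∈ closure {b : A | IsSelfAdjoint b ∧ IsUnit b}

/-- A family of mutually orthogonal projections. -/
def IsOrthogonalProjections {R ι : Type*} [Mul R] [Star R] [Zero R] (p : ι → R) : Prop :=
  (∀ i, IsStarProjection (p i)) ∧ Pairwise fun i j => p i * p j = 0

/-- The corner `p A p` of `A`. -/
def cornerSet {A : Type*} [Mul A] (p : A) : Set A := {x | ∃ y, x = p * y * p}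

/-- The matrices over `A`, with index set `ι`, all of whose entries lie in `S`. Used for
`M_N(I)` with `I` an ideal of `A` and for `M_N(p A p)` with `p` a projection of `A`; both are
C⋆-subalgebras of `M_N(A)` and carry the norm of `M_N(A)`. -/
def matricesOver (ι : Type*) {A : Type*} (S : Set A) : Set (CStarMatrix ι ι A) :=
  {M | ∀ i j, M i j ∈ S}

/-- The diagonal matrix with all diagonal entries equal to `p`; for a projection `p` this is
the unit of `M_N(p A p)`. -/
def scalarDiag (ι : Type*) [DecidableEq ι] {A : Type*} [Zero A] (p : A) : CStarMatrix ι ι A :=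
  CStarMatrix.ofMatrix (Matrix.diagonal fun _ => p)

/-- The block diagonal matrix `a ⊕ M`, where `a` is an element of `A` and `M` is a matrix over
`A`. For `M` of size `N` the index set `Unit ⊕ ι` has `N + 1` elements. -/
def oplus {ι A : Type*} [Zero A] (a : A) (M : CStarMatrix ι ι A) :
    CStarMatrix (Unit ⊕ ι) (Unit ⊕ ι) A :=
  CStarMatrix.ofMatrix
    (Matrix.fromBlocks (Matrix.of fun _ _ => a) 0 0 (CStarMatrix.ofMatrix.symm M))

/-- The block diagonal matrix `M 0 ⊕ ⋯ ⊕ M (n - 1)`, where `M k` has size `N k`. The index set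
`Σ k, Fin (N k)` has `N 0 + ⋯ + N (n - 1)` elements. -/
def bigOplus {n : ℕ} {N : Fin n → ℕ} {A : Type*} [Zero A]
    (M : ∀ k, CStarMatrix (Fin (N k)) (Fin (N k)) A) :
    CStarMatrix (Σ k, Fin (N k)) (Σ k, Fin (N k)) A :=
  CStarMatrix.ofMatrix (Matrix.blockDiagonal' fun k => CStarMatrix.ofMatrix.symm (M k))

/-- Condition `D_F` of a (compact metric) space `Y` and a (finite) set `F` of continuous complex
functions on `Y`. The order on `B` is the usual order of a C⋆-algebra, which
`StarOrderedRing` determines uniquely. -/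
def ConditionD (Y : Type v) [TopologicalSpace Y] (F : Set C(Y, ℂ)) : Prop :=
  ∀ ε : ℝ, 0 < ε → ∃ δ : ℝ, 0 < δ ∧ ∃ N : ℕ, 0 < N ∧
    ∀ (B : Type u) [CStarAlgebra B] [PartialOrder B] [StarOrderedRing B]
      (φ : C(Y, ℂ) →⋆ₐ[ℂ] B) (p : B), IsStarProjection p →
      (∀ f ∈ F, ‖p * φ f - φ f * p‖ < δ) →
      ∃ (m r : ℕ) (ξ : Fin m → Y) (lam : Fin r → Y)
        (P : Fin m → CStarMatrix (Fin N) (Fin N) B)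
        (Q : Fin r → CStarMatrix (Unit ⊕ Fin N) (Unit ⊕ Fin N) B),
        IsOrthogonalProjections P ∧ (∀ j, P j ∈ matricesOver (Fin N) (cornerSet p)) ∧
        IsOrthogonalProjections Q ∧ (∀ l, Q l ∈ matricesOver (Unit ⊕ Fin N) (cornerSet p)) ∧
        ∑ j, P j = scalarDiag (Fin N) p ∧
        ∑ l, Q l = scalarDiag (Unit ⊕ Fin N) p ∧
        ∀ f ∈ F,
          ‖oplus (p * φ f * p) (∑ j, f (ξ j) • P j) - ∑ l, f (lam l) • Q l‖ < ε

/-! Put E = 1 - p, a projection in I_0 that nearly commutes with φ. The proof pushes E down the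
chain of ideals one step at a time, until it lands in I_n = 0.

One step. Modulo I_1 the map φ factors through C(X_1), so condition D makes the compression of φ by
E, after adding a diagonal block, close to a diagonal element Σ f(λ_l) q_l over A/I_1. Real rank
zero lifts the projections of both families to orthogonal projections P_j and Q_l over A. Upstairs
the approximation then holds up to a small error plus, for each f, an element over I_1. Real rank
zero also provides projections r_l ≤ Q_l over I_1 that almost act as units on these elements, so
that the error becomes small on the projections G_l = Q_l - r_l. The remainder e = (E ⊕ ΣP_j) - ΣG_l
is a projection over I_1 that nearly commutes with the dilated unital homomorphism f ↦ φ(f) ⊕ (Σ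
f(ξ_j) P_j + f(x₀)(1 - ΣP_j)).

That homomorphism takes values in a matrix algebra over A, which again has real rank zero. It still
sends functions vanishing on X_k into matrices over I_k, because x₀ and the ξ_j ∈ X_1 lie in X_k.
Hence the step can be repeated with e and the shorter chain. Condition D is uniform over all
C*-algebras, so the tolerances can be fixed in advance, from the last step back to the first.

The step is `HasRealRankZero.exists_diagonal_splitting` together with
`exists_splitting_of_conditionD`; two stages are glued in `hasDiagonalDilation_succ`, and the
induction is `exists_hasDiagonalDilation`. -/

/-! ### Spectral projections of invertible self-adjoint elements. -/

section SpectralProjection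

open scoped CStarAlgebra

variable {C : Type*} [CStarAlgebra C]

/-- The spectral projection of `c` for the positive reals, when `c` is self-adjoint and
invertible. -/
noncomputable def posProj (c : C) : C := cfc (fun x : ℝ => if 0 < x then (1 : ℝ) else 0) c

/-- The jump is at zero, which invertibility removes from the spectrum. Without continuity `cfc`
would return its default value 0. -/
theorem continuousOn_indicator_pos {c : C} (hc : IsUnit c) :
    ContinuousOn (fun x : ℝ => if 0 < x then (1 : ℝ) else 0) (spectrum ℝ c) := by
  intro x hx
  have hx0 : x ≠ 0 := by
    rintro rfl
    exact spectrum.zero_notMem ℝ hc hx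
  refine ContinuousAt.continuousWithinAt ?_
  rcases lt_or_gt_of_ne hx0 with h | h
  · refine (continuousAt_const (y := (0 : ℝ))).congr ?_
    filter_upwards [gt_mem_nhds h] with y hy
    rw [if_neg (not_lt.2 hy.le)]
  · refine (continuousAt_const (y := (1 : ℝ))).congr ?_
    filter_upwards [lt_mem_nhds h] with y hy
    rw [if_pos hy]

theorem isStarProjection_posProj {c : C} (hc : IsUnit c) : IsStarProjection (posProj c) := by
  refine ⟨?_, cfc_predicate _ c⟩
  have h := continuousOn_indicator_pos hc
  unfold IsIdempotentElem posProj
  rw [← cfc_mul _ _ c h h]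
  refine cfc_congr fun x _ => ?_
  by_cases hx : 0 < x <;> simp [hx]

theorem commute_posProj {c x : C} (hsa : IsSelfAdjoint c) (h : Commute c x) :
    Commute (posProj c) x :=
  (hsa.commute_cfc h _)

theorem map_posProj {B : Type*} [CStarAlgebra B] (π : C →⋆ₐ[ℂ] B) {c : C} (hsa : IsSelfAdjoint c)
    (hc : IsUnit c) : π (posProj c) = posProj (π c) :=
  StarAlgHom.map_cfc π _ c (continuousOn_indicator_pos hc)
    (map_continuous π) hsa (hsa.map π)

/-- The compression is the functional calculus of the function equal to 0 for x > 0 and to x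
otherwise. -/
theorem compress_posProj_nonpos [PartialOrder C] [StarOrderedRing C] {c : C}
    (hsa : IsSelfAdjoint c) (hc : IsUnit c) :
    (1 - posProj c) * c * (1 - posProj c) ≤ 0 := by
  have h := continuousOn_indicator_pos hc
  have h1 : (1 - posProj c) * c * (1 - posProj c) =
      cfc (fun x : ℝ => (1 - (if 0 < x then (1 : ℝ) else 0)) * x *
        (1 - (if 0 < x then (1 : ℝ) else 0))) c := by
    rw [cfc_mul _ _ c, cfc_mul _ _ c, cfc_sub _ _ c, cfc_const_one ℝ c, cfc_id' ℝ c]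
    rfl
  rw [h1]
  refine cfc_nonpos _ c fun x _ => ?_
  by_cases hx : 0 < x
  · simp [hx]
  · simpa only [hx, if_false, sub_zero, one_mul, mul_one] using not_lt.1 hx

theorem abs_add_le_of_mem_spectrum {c : C} {x : ℝ} (hx : x ∈ spectrum ℝ c) (t : ℝ) :
    |x + t| ≤ ‖c + algebraMap ℝ C t‖ := by
  have : Nontrivial C := by
    by_contra hC
    rw [not_nontrivial_iff_subsingleton] at hC
    simp at hx
  have : x + t ∈ spectrum ℝ (c + algebraMap ℝ C t) := by
    rw [add_comm c]
    exact spectrum.add_mem_add_iff.2 hx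
  simpa using spectrum.norm_le_norm_of_mem this

/-- An element within t of -t has negative spectrum. This later shows that a spectral projection
lies in the kernel of a quotient map. -/
theorem posProj_eq_zero {c : C} {t : ℝ} (h : ‖c + algebraMap ℝ C t‖ < t) :
    posProj c = 0 := by
  unfold posProj
  rw [← cfc_zero ℝ c]
  refine cfc_congr fun x hx => ?_
  have := (abs_le.1 (abs_add_le_of_mem_spectrum hx t)).2
  simp only [Pi.zero_apply, ite_eq_right_iff, one_ne_zero, imp_false, not_lt]
  linarith

theorem IsStarProjection.norm_le_one {q : C} (hq : IsStarProjection q) : ‖q‖ ≤ 1 := by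
  have h := CStarRing.norm_star_mul_self (x := q)
  rw [hq.isSelfAdjoint.star_eq, hq.isIdempotentElem.eq] at h
  by_contra hlt
  push Not at hlt
  nlinarith

/-- Spectral gap of an element near `q - 1/2`. -/
theorem abs_sq_sub_le_of_mem_spectrum {c q : C} (hsa : IsSelfAdjoint c) (hq : IsStarProjection q)
    {η : ℝ} (hη : η ≤ 1) (h : ‖c - (q - algebraMap ℝ C (1 / 2))‖ ≤ η)
    {x : ℝ} (hx : x ∈ spectrum ℝ c) : |x ^ 2 - 1 / 4| ≤ 3 * η := by
  have : Nontrivial C := by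
    by_contra hC
    rw [not_nontrivial_iff_subsingleton] at hC
    simp at hx
  set s := q - algebraMap ℝ C (1 / 2) with hs
  have hss : s * s = algebraMap ℝ C (1 / 4) := by
    rw [hs, sub_mul, mul_sub, mul_sub, hq.isIdempotentElem.eq, ← map_mul,
      ← Algebra.commutes, Algebra.algebraMap_eq_smul_one, Algebra.algebraMap_eq_smul_one,
      Algebra.algebraMap_eq_smul_one, smul_mul_assoc, one_mul]
    module
  have hsn : ‖s‖ ≤ 1 := by
    have hsta : IsSelfAdjoint s := hq.isSelfAdjoint.sub (.algebraMap C (.all _))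
    have h2 := CStarRing.norm_star_mul_self (x := s)
    rw [hsta.star_eq, hss, norm_algebraMap', Real.norm_eq_abs] at h2
    norm_num at h2
    nlinarith [norm_nonneg s]
  have hη0 : 0 ≤ η := (norm_nonneg _).trans h
  -- With s = q - 1/2 one has s² = 1/4, and c² - s² is a sum of three products each of norm at most
  -- η.
  have h3 : ‖c * c - algebraMap ℝ C (1 / 4)‖ ≤ 3 * η := by
    have h4 : c * c - algebraMap ℝ C (1 / 4) = (c - s) * (c - s) + (c - s) * s + s * (c - s) := by
      rw [← hss]; noncomm_ring
    rw [h4]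
    calc _ ≤ ‖c - s‖ * ‖c - s‖ + ‖c - s‖ * ‖s‖ + ‖s‖ * ‖c - s‖ :=
          (norm_add₃_le).trans (by gcongr <;> exact norm_mul_le _ _)
      _ ≤ 1 * η + η * 1 + 1 * η := by gcongr; exact h.trans hη
      _ = 3 * η := by ring
  have h5 : c * c - algebraMap ℝ C (1 / 4) = cfc (fun x : ℝ => x ^ 2 - 1 / 4) c := by
    rw [cfc_sub _ _ c, cfc_pow _ _ c, cfc_const _ c, cfc_id' ℝ c, sq]
  rw [h5] at h3
  simpa using (norm_apply_le_norm_cfc (fun x : ℝ => x ^ 2 - 1 / 4) c hx).trans h3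

/-- At the spectral value 0 the gap estimate would read 1/4 ≤ 3η. -/
theorem isUnit_of_near_projection {c q : C} (hsa : IsSelfAdjoint c) (hq : IsStarProjection q)
    {η : ℝ} (hη : 12 * η < 1) (h : ‖c - (q - algebraMap ℝ C (1 / 2))‖ ≤ η) : IsUnit c := by
  rw [← spectrum.zero_notMem_iff ℝ]
  intro h0
  have := abs_sq_sub_le_of_mem_spectrum hsa hq (by linarith) h h0
  norm_num at this
  linarith

/-- On the spectrum |x - 1/2| |x + 1/2| ≤ 3η, and the factor belonging to the wrong sign is at least
1/2. So the indicator differs from x + 1/2 by at most 6η; passing from c + 1/2 to q costs another η.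
-/
theorem norm_posProj_sub_le {c q : C} (hsa : IsSelfAdjoint c) (hc : IsUnit c)
    (hq : IsStarProjection q)
    {η : ℝ} (hη : η ≤ 1) (h : ‖c - (q - algebraMap ℝ C (1 / 2))‖ ≤ η) :
    ‖posProj c - q‖ ≤ 7 * η := by
  have hη0 : 0 ≤ η := (norm_nonneg _).trans h
  have hcont := continuousOn_indicator_pos hc
  have h1 : posProj c - (c + algebraMap ℝ C (1 / 2)) =
      cfc (fun x : ℝ => (if 0 < x then (1 : ℝ) else 0) - (x + 1 / 2)) c := by
    rw [cfc_sub _ _ c, cfc_add c _ _, cfc_const _ c, cfc_id' ℝ c]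
    rfl
  have h2 : ‖posProj c - (c + algebraMap ℝ C (1 / 2))‖ ≤ 6 * η := by
    rw [h1]
    refine norm_cfc_le (by positivity) fun x hx => ?_
    have h3 := abs_le.1 (abs_sq_sub_le_of_mem_spectrum hsa hq hη h hx)
    rw [Real.norm_eq_abs, abs_le]
    split_ifs with hx0
    · constructor <;> nlinarith
    · push Not at hx0
      constructor <;> nlinarith
  calc ‖posProj c - q‖ = ‖(posProj c - (c + algebraMap ℝ C (1 / 2)))
        + (c - (q - algebraMap ℝ C (1 / 2)))‖ := by congr 1; abel
    _ ≤ 6 * η + η := (norm_add_le _ _).trans (add_le_add h2 h)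
    _ = 7 * η := by ring

theorem posProj_sub_half {q : C} (hq : IsStarProjection q) :
    posProj (q - algebraMap ℝ C (1 / 2)) = q := by
  have hsa : IsSelfAdjoint (q - algebraMap ℝ C (1 / 2)) :=
    hq.isSelfAdjoint.sub (.algebraMap C (.all _))
  have h0 : ‖(q - algebraMap ℝ C (1 / 2)) - (q - algebraMap ℝ C (1 / 2))‖ ≤ (0 : ℝ) := by simp
  have := norm_posProj_sub_le hsa (isUnit_of_near_projection hsa hq (by simp) h0) hq
    zero_le_one h0
  rw [mul_zero] at this
  exact sub_eq_zero.1 (norm_le_zero_iff.1 this)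

end SpectralProjection

/-! ### Real rank zero of corners and of sums of corners, by Schur complements. -/

section RealRankZero

variable {C : Type*} [CStarAlgebra C]

/-- The upper-diagonal-lower factorization of the block matrix with diagonal s + b d⁻¹ b', d and
off-diagonal b, b'. Here d' is the inverse of d in the corner of F, and Z is a part orthogonal to F.
-/
theorem schur_factorization {R : Type*} [Ring R] {E F s d d' b b' Z : R}
    (hsE : s * E = s) (hEs : E * s = s) (hd : d' * d = F) (hd2 : d * d' = F)
    (hb : b * F = b) (hb' : F * b' = b') (hEF : E * F = 0) (hFE : F * E = 0)
    (hFd' : F * d' = d') (hd'F : d' * F = d') (hZF : Z * F = 0) (hFZ : F * Z = 0) :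
    s + b * d' * b' + b + b' + d + Z = (1 + b * d') * (s + d + Z) * (1 + d' * b') := by
  have h1 : d' * s = 0 := by rw [← hd'F, ← hEs, mul_assoc, ← mul_assoc F, hFE]; simp
  have h2 : s * d' = 0 := by rw [← hFd', ← hsE, mul_assoc, ← mul_assoc E, hEF]; simp
  have h3 : d' * Z = 0 := by rw [← hd'F, mul_assoc, hFZ, mul_zero]
  have h4 : Z * d' = 0 := by rw [← hFd', ← mul_assoc, hZF, zero_mul]
  have h5 : (1 + b * d') * (s + d + Z) = s + d + Z + b := by
    rw [add_mul, one_mul, mul_assoc, mul_add d', mul_add d', h1, h3, hd, zero_add, add_zero, hb]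
  have h6 : b * d' * b' = b * (d' * b') := mul_assoc _ _ _
  rw [h5, mul_add, mul_one, ← mul_assoc]
  simp only [add_mul, h2, hd2, h4, hb', zero_mul]
  abel

theorem isUnit_one_add_of_sq_zero {R : Type*} [Ring R] {x : R} (h : x * x = 0) :
    IsUnit (1 + x) := by
  refine ⟨⟨1 + x, 1 - x, ?_, ?_⟩, rfl⟩ <;> simp [mul_add, add_mul, mul_sub, sub_mul, h]

/-- The corner `E C E` has real rank zero: its invertible self-adjoint elements are dense among the
self-adjoint ones. Invertibility in the corner is expressed by adding the complement of the unit. -/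
def CornerRealRankZero (E : C) : Prop :=
  ∀ a : C, IsSelfAdjoint a → E * a * E = a → ∀ ε : ℝ, 0 < ε →
    ∃ b : C, IsSelfAdjoint b ∧ E * b * E = b ∧ ‖b - a‖ < ε ∧ IsUnit (b + (1 - E))

theorem cornerRealRankZero_one_iff : CornerRealRankZero (1 : C) ↔ HasRealRankZero C := by
  constructor
  · intro h a ha
    rw [Metric.mem_closure_iff]
    intro ε hε
    obtain ⟨b, hb, -, hba, hu⟩ := h a ha (by simp) ε hε
    exact ⟨b, ⟨hb, by simpa using hu⟩, by rwa [dist_comm, dist_eq_norm]⟩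
  · intro h a ha _ ε hε
    obtain ⟨b, ⟨hb, hu⟩, hba⟩ := Metric.mem_closure_iff.1 (h a ha) ε hε
    exact ⟨b, hb, by simp, by rwa [dist_comm, dist_eq_norm] at hba, by simpa using hu⟩

/-- An inverse in the corner. -/
theorem exists_corner_inverse {R : Type*} [Ring R] {F d : R} (hF : F * F = F) (hFd : F * d * F = d)
    (hu : IsUnit (d + (1 - F))) :
    ∃ d', F * d' = d' ∧ d' * F = d' ∧ d * d' = F ∧ d' * d = F := by
  obtain ⟨u, hu⟩ := hu
  have h1 : F * d = d := by rw [← hFd, ← mul_assoc, ← mul_assoc, hF]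
  have h2 : d * F = d := by rw [← hFd, mul_assoc, hF]
  have hcomm : Commute (u : R) F := by
    rw [hu, commute_iff_eq]
    simp [add_mul, mul_add, mul_sub, sub_mul, h1, h2]
  have hc' : Commute (↑u⁻¹ : R) F := hcomm.units_inv_left
  have hdu : d = F * u := by rw [hu, mul_add, mul_sub, h1, hF]; simp
  refine ⟨F * ↑u⁻¹, ?_, ?_, ?_, ?_⟩
  · rw [← mul_assoc, hF]
  · rw [mul_assoc, hc'.eq, ← mul_assoc, hF]
  · rw [← mul_assoc, h2, hdu, mul_assoc, Units.mul_inv, mul_one]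
  · rw [hdu, mul_assoc, ← mul_assoc _ F, hc'.eq, mul_assoc, Units.inv_mul, mul_one, hF]

/-- Perturb the F-corner to an invertible d, then perturb the Schur complement E a E - b d' b* to an
invertible s, keeping the off-diagonal entries. The factorization makes the reassembled element
invertible, and its distance to a is at most the sum of the two perturbations. -/
theorem CornerRealRankZero.add {E F : C} (hE : IsStarProjection E) (hF : IsStarProjection F)
    (hEF : E * F = 0) (h1 : CornerRealRankZero E) (h2 : CornerRealRankZero F) :
    CornerRealRankZero (E + F) := by
  intro a ha haEF ε hε
  have hE2 := hE.isIdempotentElem.eq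
  have hF2 := hF.isIdempotentElem.eq
  have hEs := hE.isSelfAdjoint.star_eq
  have hFs := hF.isSelfAdjoint.star_eq
  have hFE : F * E = 0 := by
    have := congrArg star hEF
    simpa [hEs, hFs] using this
  have hsa (G x : C) (hG : star G = G) (hx : IsSelfAdjoint x) : IsSelfAdjoint (G * x * G) := by
    rw [IsSelfAdjoint, star_mul, star_mul, hG, hx.star_eq, mul_assoc]
  obtain ⟨d, hd, hFdF, hda, hdu⟩ := h2 (F * a * F) (hsa F a hFs ha)
    (by simp only [mul_assoc, hF2]; rw [← mul_assoc F F, hF2]) (ε / 2) (by positivity)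
  obtain ⟨d', hFd', hd'F, hdd', hd'd⟩ := exists_corner_inverse hF2 hFdF hdu
  have hFd : F * d = d := by rw [← hFdF, ← mul_assoc, ← mul_assoc, hF2]
  have hdF : d * F = d := by rw [← hFdF, mul_assoc, hF2]
  have hd's : star d' = d' := by
    have h3 : star d' * d = F := by
      have := congrArg star hdd'
      rwa [star_mul, hd.star_eq, hFs] at this
    have h4 : star d' * F = star d' := by
      have := congrArg star hFd'
      rwa [star_mul, hFs] at this
    rw [← h4, ← hdd', ← mul_assoc, h3, hFd']
  obtain ⟨b, hb⟩ : ∃ y, y = E * a * F := ⟨_, rfl⟩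
  have hbs : star b = F * a * E := by
    rw [hb, star_mul, star_mul, ha.star_eq, hEs, hFs, mul_assoc]
  have hbF : b * F = b := by rw [hb, mul_assoc, hF2]
  have hEb : E * b = b := by rw [hb, ← mul_assoc, ← mul_assoc, hE2]
  have hFb' : F * star b = star b := by rw [hbs, ← mul_assoc, ← mul_assoc, hF2]
  have hb'E : star b * E = star b := by rw [hbs, mul_assoc, hE2]
  obtain ⟨t, ht⟩ : ∃ y, y = b * d' * star b := ⟨_, rfl⟩
  have htE : E * t * E = t := by
    rw [ht, mul_assoc, mul_assoc _ (star b) E, hb'E, ← mul_assoc, ← mul_assoc, hEb]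
  have htsa : IsSelfAdjoint t := by
    rw [IsSelfAdjoint, ht, star_mul, star_mul, star_star, hd's, mul_assoc]
  obtain ⟨s, hs, hEsE, hsa', hsu⟩ := h1 (E * a * E - t) ((hsa E a hEs ha).sub htsa)
    (by
      rw [mul_sub, sub_mul, htE]
      congr 1
      simp only [mul_assoc, hE2]; rw [← mul_assoc E E, hE2]) (ε / 2) (by positivity)
  have hEs' : E * s = s := by rw [← hEsE, ← mul_assoc, ← mul_assoc, hE2]
  have hsE' : s * E = s := by rw [← hEsE, mul_assoc, hE2]
  have hsF : s * F = 0 := by rw [← hsE', mul_assoc, hEF, mul_zero]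
  have hFs' : F * s = 0 := by rw [← hEs', ← mul_assoc, hFE, zero_mul]
  have hdE : d * E = 0 := by rw [← hdF, mul_assoc, hFE, mul_zero]
  have hEd : E * d = 0 := by rw [← hFd, ← mul_assoc, hEF, zero_mul]
  have hsd : s * d = 0 := by rw [← hFd, ← mul_assoc, hsF, zero_mul]
  have hEF1 : E * (E + F) = E := by rw [mul_add, hE2, hEF, add_zero]
  have hEF2 : (E + F) * E = E := by rw [add_mul, hE2, hFE, add_zero]
  have hEF3 : F * (E + F) = F := by rw [mul_add, hF2, hFE, zero_add]
  have hEF4 : (E + F) * F = F := by rw [add_mul, hF2, hEF, zero_add]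
  refine ⟨s + t + b + star b + d, ?_, ?_, ?_, ?_⟩
  · have : IsSelfAdjoint (b + star b) := IsSelfAdjoint.add_star_self b
    have := (hs.add htsa).add (this.add hd)
    convert this using 1
    abel
  · have key (G H x : C) (hG : (E + F) * G = G) (hH : H * (E + F) = H) (hx : G * x * H = x) :
        (E + F) * x * (E + F) = x := by
      rw [← hx, mul_assoc (E + F), mul_assoc _ H, hH, ← mul_assoc, ← mul_assoc, hG]
    have hFbE : F * star b * E = star b := by rw [hFb', hb'E]
    have hEbF : E * b * F = b := by rw [hEb, hbF]
    simp only [mul_add (E + F), add_mul _ _ (E + F), key E E s hEF2 hEF1 hEsE,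
      key E E t hEF2 hEF1 htE,
      key E F b hEF2 hEF3 hEbF, key F E (star b) hEF4 hEF1 hFbE, key F F d hEF4 hEF3 hFdF]
  · have hdec : s + t + b + star b + d - a = (s - (E * a * E - t)) + (d - F * a * F) := by
      rw [hbs, hb]
      have haEF' : a = E * a * E + F * a * E + (E * a * F + F * a * F) := by
        conv_lhs => rw [← haEF]
        rw [mul_add, add_mul, add_mul, add_mul]
      have : s + t + E * a * F + F * a * E + d - a = s + t + E * a * F + F * a * E + d -
        (E * a * E + F * a * E + (E * a * F + F * a * F)) := by rw [← haEF']
      rw [this]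
      abel
    rw [hdec]
    linarith [norm_add_le (s - (E * a * E - t)) (d - F * a * F)]
  · have hZ1 : (1 - (E + F)) * F = 0 := by rw [sub_mul, hEF4, one_mul, sub_self]
    have hZ2 : F * (1 - (E + F)) = 0 := by rw [mul_sub, hEF3, mul_one, sub_self]
    rw [ht, schur_factorization hsE' hEs' hd'd hdd' hbF hFb' hEF hFE hFd' hd'F hZ1 hZ2]
    have hd'b : d' * b = 0 := by
      rw [← hd'F, ← hEb, mul_assoc, ← mul_assoc F, hFE]; simp
    have hb'd' : star b * d' = 0 := by
      rw [← hFd', ← hb'E, mul_assoc, ← mul_assoc E, hEF]; simp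
    -- The middle factor is a product of the two corner elements, each completed by the complement
    -- of its unit.
    have hmid : s + d + (1 - (E + F)) = (s + (1 - E)) * (d + (1 - F)) := by
      have : (s + (1 - E)) * (d + (1 - F)) =
        s * d + s - s * F + d - E * d + 1 - F - E + E * F := by noncomm_ring
      rw [this, hsd, hsF, hEd, hEF]; abel
    rw [hmid]
    refine IsUnit.mul (IsUnit.mul ?_ (hsu.mul hdu)) ?_
    · refine isUnit_one_add_of_sq_zero ?_
      rw [mul_assoc, ← mul_assoc d', hd'b]; simp
    · refine isUnit_one_add_of_sq_zero ?_
      rw [mul_assoc, ← mul_assoc (star b), hb'd']; simp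

/-- Approximate a + (1 - E) by an invertible x of the whole algebra. Its F-corner is close to F,
hence invertible there, and the Schur complement of x is an invertible element of the E-corner close
to a. -/
theorem HasRealRankZero.corner (h : HasRealRankZero C) {E : C} (hE : IsStarProjection E) :
    CornerRealRankZero E := by
  intro a ha haE ε hε
  have hE2 := hE.isIdempotentElem.eq
  have hEs := hE.isSelfAdjoint.star_eq
  obtain ⟨F, hFdef⟩ : ∃ F, F = 1 - E := ⟨_, rfl⟩
  have hF : IsStarProjection F := hFdef ▸ hE.one_sub
  have hF2 := hF.isIdempotentElem.eq
  have hFs := hF.isSelfAdjoint.star_eq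
  have hEF : E * F = 0 := by rw [hFdef, mul_sub, mul_one, hE2, sub_self]
  have hFE : F * E = 0 := by rw [hFdef, sub_mul, one_mul, hE2, sub_self]
  have hEa : E * a = a := by rw [← haE, ← mul_assoc, ← mul_assoc, hE2]
  have haE' : a * E = a := by rw [← haE, mul_assoc, hE2]
  have hFa : F * a = 0 := by rw [← hEa, ← mul_assoc, hFE, zero_mul]
  have haF : a * F = 0 := by rw [← haE', mul_assoc, hEF, mul_zero]
  have hEn : ‖E‖ ≤ 1 := hE.norm_le_one
  have hFn : ‖F‖ ≤ 1 := hF.norm_le_one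
  -- The bound 1/2 gives ‖d'‖ ≤ 2 and ‖b‖ ≤ 1/2, so the correction b d' b* has norm at most η. The
  -- total error 2η stays below ε.
  set η := min (1 / 2) (ε / 4) with hη
  have hη0 : 0 < η := by positivity
  have hη1 : η ≤ 1 / 2 := min_le_left _ _
  have hη2 : η ≤ ε / 4 := min_le_right _ _
  obtain ⟨x, ⟨hx, hxu⟩, hxa⟩ := Metric.mem_closure_iff.1 (h (a + F) (ha.add hF.isSelfAdjoint)) η hη0
  rw [dist_comm, dist_eq_norm] at hxa
  have hcut (G H : C) (hG : ‖G‖ ≤ 1) (hH : ‖H‖ ≤ 1) : ‖G * (x - (a + F)) * H‖ ≤ η :=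
    calc _ ≤ ‖G‖ * ‖x - (a + F)‖ * ‖H‖ := (norm_mul_le _ _).trans (by gcongr; exact norm_mul_le _ _)
      _ ≤ 1 * η * 1 := by gcongr
      _ = η := by ring
  have hsa (G : C) (hG : star G = G) : IsSelfAdjoint (G * x * G) := by
    rw [IsSelfAdjoint, star_mul, star_mul, hG, hx.star_eq, mul_assoc]
  obtain ⟨d, hd⟩ : ∃ y, y = F * x * F := ⟨_, rfl⟩
  have hdF' : ‖d - F‖ ≤ η := by
    have : d - F = F * (x - (a + F)) * F := by
      rw [mul_sub, sub_mul, mul_add, hFa, hF2, zero_add, hF2, hd]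
    rw [this]
    exact hcut _ _ hFn hFn
  have hFdF : F * d * F = d := by
    rw [hd]; simp only [mul_assoc, hF2]; rw [← mul_assoc F F, hF2]
  have hFd : F * d = d := by rw [← hFdF, ← mul_assoc, ← mul_assoc, hF2]
  have hdF : d * F = d := by rw [← hFdF, mul_assoc, hF2]
  have hdu : IsUnit (d + (1 - F)) := by
    have := isUnit_one_sub_of_norm_lt_one (x := F - d)
      (by rw [norm_sub_rev]; linarith)
    convert this using 1
    abel
  obtain ⟨d', hFd', hd'F, hdd', hd'd⟩ := exists_corner_inverse hF2 hFdF hdu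
  have hd's : star d' = d' := by
    have h3 : star d' * d = F := by
      have := congrArg star hdd'
      rwa [star_mul, hd, (hsa F hFs).star_eq, ← hd, hFs] at this
    have h4 : star d' * F = star d' := by
      have := congrArg star hFd'
      rwa [star_mul, hFs] at this
    rw [← h4, ← hdd', ← mul_assoc, h3, hFd']
  have hd'n : ‖d'‖ ≤ 2 := by
    have : d' = F - (d - F) * d' := by rw [sub_mul, hdd', hFd']; abel
    have h4 : ‖d'‖ ≤ 1 + η * ‖d'‖ := by
      calc ‖d'‖ = ‖F - (d - F) * d'‖ := by rw [← this]
        _ ≤ ‖F‖ + ‖d - F‖ * ‖d'‖ := (norm_sub_le _ _).trans (by gcongr; exact norm_mul_le _ _)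
        _ ≤ 1 + η * ‖d'‖ := by gcongr
    nlinarith [norm_nonneg d']
  obtain ⟨b, hb⟩ : ∃ y, y = E * x * F := ⟨_, rfl⟩
  have hbn : ‖b‖ ≤ η := by
    have : b = E * (x - (a + F)) * F := by
      rw [mul_sub, sub_mul, mul_add, hEa, hEF, add_zero, haF, sub_zero, hb]
    rw [this]
    exact hcut _ _ hEn hFn
  have hbs : star b = F * x * E := by
    rw [hb, star_mul, star_mul, hx.star_eq, hEs, hFs, mul_assoc]
  have hbF : b * F = b := by rw [hb, mul_assoc, hF2]
  have hEb : E * b = b := by rw [hb, ← mul_assoc, ← mul_assoc, hE2]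
  have hFb' : F * star b = star b := by rw [hbs, ← mul_assoc, ← mul_assoc, hF2]
  have hb'E : star b * E = star b := by rw [hbs, mul_assoc, hE2]
  obtain ⟨t, ht⟩ : ∃ y, y = b * d' * star b := ⟨_, rfl⟩
  have htE : E * t * E = t := by
    rw [ht, mul_assoc, mul_assoc _ (star b) E, hb'E, ← mul_assoc, ← mul_assoc, hEb]
  have htsa : IsSelfAdjoint t := by
    rw [IsSelfAdjoint, ht, star_mul, star_mul, star_star, hd's, mul_assoc]
  have htn : ‖t‖ ≤ η := by
    calc ‖t‖ ≤ ‖b‖ * ‖d'‖ * ‖star b‖ := ht ▸ norm_mul₃_le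
      _ ≤ η * 2 * (1 / 2) := by rw [norm_star]; gcongr; exact hbn.trans hη1
      _ = η := by ring
  obtain ⟨s, hs⟩ : ∃ y, y = E * x * E - t := ⟨_, rfl⟩
  have hEsE : E * s * E = s := by
    rw [hs, mul_sub, sub_mul, htE]
    congr 1
    simp only [mul_assoc, hE2]
    try rw [← mul_assoc E E, hE2]
  have hEs' : E * s = s := by rw [← hEsE, ← mul_assoc, ← mul_assoc, hE2]
  have hsE' : s * E = s := by rw [← hEsE, mul_assoc, hE2]
  have hsF : s * F = 0 := by rw [← hsE', mul_assoc, hEF, mul_zero]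
  have hsd : s * d = 0 := by rw [← hFd, ← mul_assoc, hsF, zero_mul]
  have hEd : E * d = 0 := by rw [← hFd, ← mul_assoc, hEF, zero_mul]
  refine ⟨s, hs ▸ (hsa E hEs).sub htsa, hEsE, ?_, ?_⟩
  · have : s - a = E * (x - (a + F)) * E - t := by
      rw [mul_sub, sub_mul, mul_add, hEa, hEF, add_zero, haE', hs]
      abel
    rw [this]
    linarith [norm_sub_le (E * (x - (a + F)) * E) t, hcut E E hEn hEn]
  · have hfac := schur_factorization (Z := (0 : C)) hsE' hEs' hd'd hdd' hbF hFb' hEF hFE hFd' hd'F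
      (zero_mul _) (mul_zero _)
    have hx' : s + b * d' * star b + b + star b + d + 0 = x := by
      have hEF1 : E + F = 1 := by rw [hFdef]; abel
      have : x = (E + F) * x * (E + F) := by rw [hEF1]; simp
      rw [this, ← ht, hs, hbs, hb, hd]
      noncomm_ring
    have hd'b : d' * b = 0 := by
      rw [← hd'F, ← hEb, mul_assoc, ← mul_assoc F, hFE]; simp
    have hb'd' : star b * d' = 0 := by
      rw [← hFd', ← hb'E, mul_assoc, ← mul_assoc E, hEF]; simp
    have hu1 : IsUnit (1 + b * d') := isUnit_one_add_of_sq_zero <| by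
      rw [mul_assoc, ← mul_assoc d', hd'b]; simp
    have hu2 : IsUnit (1 + d' * star b) := isUnit_one_add_of_sq_zero <| by
      rw [mul_assoc, ← mul_assoc (star b), hb'd']; simp
    have hmid : s + d + 0 = (s + (1 - E)) * (d + (1 - F)) := by
      have h1F : 1 - F = E := by rw [hFdef]; abel
      rw [h1F, ← hFdef, add_mul, mul_add, mul_add, hsd, hsE', hFd, hFE]; abel
    rw [hx', hmid] at hfac
    rw [hfac] at hxu
    -- Cancel the two unipotent factors and the F-part from the invertible x; what is left is s + (1
    -- - E).
    generalize 1 + b * d' = y1 at hxu hu1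
    generalize 1 + d' * star b = y2 at hxu hu2
    generalize d + (1 - F) = y3 at hxu hdu
    obtain ⟨u1, rfl⟩ := hu1
    obtain ⟨u2, rfl⟩ := hu2
    obtain ⟨u3, rfl⟩ := hdu
    rwa [Units.isUnit_mul_units, Units.isUnit_units_mul, Units.isUnit_mul_units] at hxu

end RealRankZero

/-! ### Lifting elements and projections from quotients. -/

section Lifting

open scoped CStarAlgebra

variable {C B : Type*} [CStarAlgebra C] [CStarAlgebra B]

/-- Truncate a lift c to c g(c*c) with g(t) = r / max(r, √|t|), r being the norm of the image. On
the spectrum of the image of c*c the function g is 1, so the image does not change, while t g(t)² ≤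
r² bounds the norm. -/
theorem exists_lift_norm_le {π : C →⋆ₐ[ℂ] B} (hπ : Function.Surjective π) (b : B) :
    ∃ c, π c = b ∧ ‖c‖ ≤ ‖b‖ := by
  obtain ⟨c, rfl⟩ := hπ b
  obtain h0 | hr := (norm_nonneg (π c)).eq_or_lt
  · exact ⟨0, by rw [map_zero, norm_eq_zero.1 h0.symm], by simp⟩
  set r := ‖π c‖ with hrdef
  set g : ℝ → ℝ := fun t => r / max r (√|t|) with hg
  have hgc : Continuous g := by
    refine continuous_const.div (by fun_prop) fun t => ?_
    exact (lt_max_of_lt_left hr).ne'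
  have hsa : IsSelfAdjoint (star c * c) := .star_mul_self c
  refine ⟨c * cfc g (star c * c), ?_, ?_⟩
  · rw [map_mul, StarAlgHom.map_cfc π g _ hgc.continuousOn (map_continuous π) hsa (hsa.map π)]
    have : cfc g (π (star c * c)) = 1 := by
      rw [← cfc_const_one ℝ (π (star c * c)) (hsa.map π)]
      refine cfc_congr fun x hx => ?_
      have h1 := abs_add_le_of_mem_spectrum hx 0
      rw [add_zero, map_zero, add_zero, map_mul, map_star, CStarRing.norm_star_mul_self,
        ← hrdef] at h1
      have h2 : √|x| ≤ r := Real.sqrt_le_iff.2 ⟨hr.le, by rw [sq]; exact h1⟩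
      simp only [hg]
      rw [max_eq_left h2, div_self hr.ne']
    rw [this, mul_one]
  · have h1 : star (c * cfc g (star c * c)) * (c * cfc g (star c * c)) =
        cfc (fun t => g t * t * g t) (star c * c) := by
      rw [cfc_mul _ _ _ (by fun_prop) (by fun_prop), cfc_mul _ _ _ (by fun_prop) (by fun_prop),
        cfc_id' ℝ (star c * c), star_mul, (cfc_predicate g (star c * c)).star_eq]
      simp only [mul_assoc]
    have h2 : ‖c * cfc g (star c * c)‖ * ‖c * cfc g (star c * c)‖ ≤ r * r := by
      rw [← CStarRing.norm_star_mul_self, h1]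
      refine norm_cfc_le (by positivity) fun t _ => ?_
      have h3 : |t| ≤ max r (√|t|) * max r (√|t|) := by
        conv_lhs => rw [← Real.mul_self_sqrt (abs_nonneg t)]
        gcongr <;> exact le_max_right _ _
      have h4 : 0 < max r (√|t|) := lt_max_of_lt_left hr
      simp only [hg, norm_mul, Real.norm_eq_abs, abs_div, abs_of_pos h4, abs_of_pos hr]
      rw [div_mul_eq_mul_div, div_mul_div_comm, div_le_iff₀ (by positivity)]
      nlinarith [mul_le_mul_of_nonneg_left h3 (mul_nonneg hr.le hr.le)]
    exact abs_le_of_sq_le_sq' (by simpa [sq] using h2) hr.le |>.2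

theorem exists_selfAdjoint_lift_norm_le {π : C →⋆ₐ[ℂ] B} (hπ : Function.Surjective π) {b : B}
    (hb : IsSelfAdjoint b) : ∃ c, IsSelfAdjoint c ∧ π c = b ∧ ‖c‖ ≤ ‖b‖ := by
  obtain ⟨c, hc, hcn⟩ := exists_lift_norm_le hπ b
  refine ⟨(1 / 2 : ℂ) • (c + star c), ?_, ?_, ?_⟩
  · rw [IsSelfAdjoint, star_smul, star_add, star_star, add_comm]
    simp
  · rw [map_smul, map_add, map_star, hc, hb.star_eq, ← two_smul ℂ, smul_smul]
    norm_num
  · rw [norm_smul]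
    have := norm_add_le c (star c)
    rw [norm_star] at this
    norm_num
    linarith

theorem IsSelfAdjoint.conjugate_proj {E x : C} (hE : IsStarProjection E) (hx : IsSelfAdjoint x) :
    IsSelfAdjoint (E * x * E) := by
  rw [IsSelfAdjoint, star_mul, star_mul, hE.isSelfAdjoint.star_eq, hx.star_eq, mul_assoc]

theorem IsStarProjection.conjugate_idem {E : C} (hE : IsStarProjection E) (x : C) :
    E * (E * x * E) * E = E * x * E := by
  have := hE.isIdempotentElem.eq
  rw [mul_assoc, mul_assoc, this, ← mul_assoc, ← mul_assoc, this]

theorem IsStarProjection.commute_of_mul_eq {E x : C} (hE : IsStarProjection E)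
    (h : E * x * E = x) : Commute x E := by
  have h2 := hE.isIdempotentElem.eq
  rw [commute_iff_eq]
  conv_lhs => rw [← h]
  conv_rhs => rw [← h]
  rw [mul_assoc, h2, ← mul_assoc, ← mul_assoc, h2]

/-- In a C⋆-algebra of real rank zero, `x - t` can be perturbed to an invertible element commuting
with a projection `E` that supports `x`. -/
theorem HasRealRankZero.exists_isUnit_near (hC : HasRealRankZero C) {E x : C}
    (hE : IsStarProjection E) (hx : IsSelfAdjoint x) (hxE : E * x * E = x) {t : ℝ} (ht : t ≠ 0)
    {ε : ℝ} (hε : 0 < ε) :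
    ∃ c, IsSelfAdjoint c ∧ IsUnit c ∧ Commute c E ∧ ‖c - (x - algebraMap ℝ C t)‖ < ε := by
  have hE2 := hE.isIdempotentElem.eq
  have hEt : E * (t • E) * E = t • E := by
    rw [mul_smul_comm, smul_mul_assoc, hE2, hE2]
  obtain ⟨b, hb, hEb, hba, hu⟩ := hC.corner hE (x - t • E)
    (hx.sub ((IsSelfAdjoint.all t).smul hE.isSelfAdjoint))
    (by rw [mul_sub, sub_mul, hxE, hEt]) ε hε
  have hbE' : b * E = b := by
    rw [← hEb, mul_assoc, hE2]
  -- Outside E the element x - t is the scalar -t, already invertible; only the corner needs a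
  -- perturbation.
  refine ⟨b - t • (1 - E), hb.sub ((IsSelfAdjoint.all t).smul hE.one_sub.isSelfAdjoint), ?_, ?_, ?_⟩
  · have h1 : b - t • (1 - E) = (b + (1 - E)) * (E - t • (1 - E)) := by
      have h2 : (1 - E) * E = 0 := hE.one_sub_mul_self
      have h3 : b * (1 - E) = 0 := by rw [mul_sub, mul_one, hbE', sub_self]
      rw [add_mul, mul_sub, mul_sub, mul_smul_comm, mul_smul_comm, hbE', h2, h3,
        hE.one_sub.isIdempotentElem.eq, smul_zero, sub_zero, zero_sub, sub_eq_add_neg]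
    rw [h1]
    refine hu.mul ⟨⟨E - t • (1 - E), E - t⁻¹ • (1 - E), ?_, ?_⟩, rfl⟩ <;>
    · simp only [mul_sub, sub_mul, smul_sub, mul_smul_comm, smul_mul_assoc, hE2, one_mul, mul_one,
        sub_self, smul_smul, mul_inv_cancel₀ ht, inv_mul_cancel₀ ht, one_smul, smul_zero]
      abel
  · refine (hE.commute_of_mul_eq hEb).sub_left (Commute.smul_left ?_ t)
    exact (Commute.one_left E).sub_left (Commute.refl E)
  · convert hba using 2
    rw [Algebra.algebraMap_eq_smul_one, smul_sub]
    abel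

theorem IsStarProjection.mul_of_commute {p q : C} (hp : IsStarProjection p)
    (hq : IsStarProjection q) (h : Commute p q) : IsStarProjection (p * q) := hp.mul hq h

/-- Projections lift from quotients of C⋆-algebras of real rank zero, below a given projection. -/
theorem HasRealRankZero.exists_lift_projection (hC : HasRealRankZero C) {π : C →⋆ₐ[ℂ] B}
    (hπ : Function.Surjective π) {E : C} (hE : IsStarProjection E) {q : B}
    (hq : IsStarProjection q) (hqE : q * π E = q) :
    ∃ e, IsStarProjection e ∧ e * E = e ∧ π e = q := by
  have hE2 := hE.isIdempotentElem.eq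
  have hEq : π E * q = q := by
    have := congrArg star hqE
    rwa [star_mul, ← map_star, hE.isSelfAdjoint.star_eq, hq.isSelfAdjoint.star_eq] at this
  obtain ⟨x, hx, hxq, -⟩ := exists_selfAdjoint_lift_norm_le hπ hq.isSelfAdjoint
  -- An arbitrary self-adjoint lift shifted by 1/2 need not be invertible; a perturbation within E
  -- makes it so. Its spectral projection then maps to within 7/128 ≤ 1/16 of q.
  obtain ⟨c, hc, hcu, hcE, hcn⟩ := hC.exists_isUnit_near hE (hx.conjugate_proj hE)
    (hE.conjugate_idem x) (t := 1 / 2) (by norm_num) (ε := 1 / 128) (by norm_num)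
  have hπc : ‖π c - (q - algebraMap ℝ B (1 / 2))‖ ≤ 1 / 128 := by
    have h1 : π c - (q - algebraMap ℝ B (1 / 2)) =
        π (c - (E * x * E - algebraMap ℝ C (1 / 2))) := by
      have : π (algebraMap ℝ C (1 / 2)) = algebraMap ℝ B (1 / 2) := by
        rw [IsScalarTower.algebraMap_apply ℝ ℂ C, IsScalarTower.algebraMap_apply ℝ ℂ B,
          AlgHomClass.commutes]
      rw [map_sub, map_sub, this, map_mul, map_mul, hxq, hEq, hqE]
    rw [h1]
    exact (NonUnitalStarAlgHom.norm_apply_le π _).trans hcn.le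
  have hr := isStarProjection_posProj hcu
  have hrE := commute_posProj hc hcE
  have hr' := hr.mul_of_commute hE hrE
  set r := posProj c * E with hrdef
  have hrr : r * E = r := by rw [hrdef, mul_assoc, hE2]
  have hErr : E * r * E = r := by rw [mul_assoc, hrr, hrdef, ← mul_assoc, ← hrE.eq, mul_assoc, hE2]
  have hπr : ‖q - π r‖ ≤ 1 / 16 := by
    have h1 : q - π r = -(π (posProj c) - q) * π E := by
      rw [neg_mul, sub_mul, hqE, hrdef, map_mul]; abel
    have h2 := norm_posProj_sub_le (hc.map π) (hcu.map π) hq (by norm_num) hπc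
    rw [← map_posProj π hc hcu] at h2
    calc ‖q - π r‖ ≤ ‖-(π (posProj c) - q)‖ * ‖π E‖ := h1 ▸ norm_mul_le _ _
      _ ≤ (7 * (1 / 128)) * 1 := by
        rw [norm_neg]; gcongr; exact (hE.map π).norm_le_one
      _ ≤ 1 / 16 := by norm_num
  -- The defect q - π r is lifted without increasing its norm. Adding it moves r - 1/2 by at most
  -- 1/16 < 1/12, so invertibility survives, and the image is now exactly q - 1/2, whose spectral
  -- projection is q.
  obtain ⟨y, hy, hyq, hyn⟩ := exists_selfAdjoint_lift_norm_le hπ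
    (hq.isSelfAdjoint.sub (hr'.map π).isSelfAdjoint)
  set z := r + E * y * E - algebraMap ℝ C (1 / 2) with hz
  have hzsa : IsSelfAdjoint z :=
    (hr'.isSelfAdjoint.add (hy.conjugate_proj hE)).sub (.algebraMap C (.all _))
  have hzn : ‖z - (r - algebraMap ℝ C (1 / 2))‖ ≤ 1 / 16 := by
    have : z - (r - algebraMap ℝ C (1 / 2)) = E * y * E := by rw [hz]; abel
    rw [this]
    calc _ ≤ ‖E‖ * ‖y‖ * ‖E‖ := (norm_mul_le _ _).trans (by gcongr; exact norm_mul_le _ _)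
      _ ≤ 1 * (1 / 16) * 1 := by
        gcongr
        · exact hE.norm_le_one
        · exact hyn.trans hπr
        · exact hE.norm_le_one
      _ = 1 / 16 := by norm_num
  have hzu : IsUnit z := isUnit_of_near_projection hzsa hr' (by norm_num) hzn
  have hzE : Commute z E := by
    refine Commute.sub_left ?_ (Algebra.commutes _ _)
    refine (hE.commute_of_mul_eq hErr).add_left ?_
    exact hE.commute_of_mul_eq (hE.conjugate_idem y)
  have hπz : π z = q - algebraMap ℝ B (1 / 2) := by
    have : π (algebraMap ℝ C (1 / 2)) = algebraMap ℝ B (1 / 2) := by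
      rw [IsScalarTower.algebraMap_apply ℝ ℂ C, IsScalarTower.algebraMap_apply ℝ ℂ B,
        AlgHomClass.commutes]
    have h3 : π E * π r * π E = π r := by rw [← map_mul, ← map_mul, hErr]
    rw [hz, map_sub, this, map_add, map_mul π (E * y), map_mul π E, hyq, mul_sub, sub_mul, hEq, hqE, h3]
    abel
  refine ⟨posProj z * E, (isStarProjection_posProj hzu).mul_of_commute hE
    (commute_posProj hzsa hzE), by rw [mul_assoc, hE2], ?_⟩
  rw [map_mul, map_posProj π hzsa hzu, hπz, posProj_sub_half hq, hqE]

theorem IsOrthogonalProjections.sum {R ι : Type*} [Ring R] [StarRing R] {p : ι → R}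
    (h : IsOrthogonalProjections p) (s : Finset ι) : IsStarProjection (∑ i ∈ s, p i) := by
  classical
  induction s using Finset.induction_on with
  | empty => simp
  | insert a s ha ih =>
    rw [Finset.sum_insert ha]
    refine (h.1 a).add ih ?_
    rw [Finset.mul_sum]
    exact Finset.sum_eq_zero fun i hi => h.2 (by rintro rfl; exact ha hi)

/-- Lifting of a family of orthogonal projections below a given projection. -/
theorem HasRealRankZero.exists_lift_projections (hC : HasRealRankZero C) {π : C →⋆ₐ[ℂ] B}
    (hπ : Function.Surjective π) (m : ℕ) : ∀ {E : C} (_ : IsStarProjection E) (q : Fin m → B)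
    (_ : IsOrthogonalProjections q) (_ : ∀ i, q i * π E = q i),
    ∃ e : Fin m → C, IsOrthogonalProjections e ∧ (∀ i, e i * E = e i) ∧ ∀ i, π (e i) = q i := by
  induction m with
  | zero =>
    intro E hE q hq hqE
    exact ⟨Fin.elim0, ⟨fun i => i.elim0, fun i => i.elim0⟩, fun i => i.elim0, fun i => i.elim0⟩
  | succ m ih =>
    intro E hE q hq hqE
    obtain ⟨e, he, heE, heq⟩ := hC.exists_lift_projection hπ hE (hq.1 0) (hqE 0)
    have hEe : E * e = e := by
      have := congrArg star heE
      rwa [star_mul, hE.isSelfAdjoint.star_eq, he.isSelfAdjoint.star_eq] at this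
    -- The remaining projections are orthogonal to q 0, hence lie below the image of E - e and can
    -- be lifted there.
    have hE' : IsStarProjection (E - e) := he.sub_of_mul_eq_left hE heE
    obtain ⟨f, hf, hfE, hfq⟩ := ih hE' (fun i => q i.succ)
      ⟨fun i => hq.1 _, fun i j hij => hq.2 (by simpa using hij)⟩
      (fun i => by rw [map_sub, mul_sub, hqE, heq, hq.2 (Fin.succ_ne_zero i), sub_zero])
    have hfe : ∀ i, f i * e = 0 := fun i => by
      rw [← hfE i, mul_assoc, sub_mul, hEe, he.isIdempotentElem.eq, sub_self, mul_zero]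
    have hef : ∀ i, e * f i = 0 := fun i => by
      have := congrArg star (hfe i)
      rwa [star_mul, (hf.1 i).isSelfAdjoint.star_eq, he.isSelfAdjoint.star_eq, star_zero] at this
    refine ⟨Fin.cons e f, ⟨?_, ?_⟩, ?_, ?_⟩
    · intro i
      cases i using Fin.cases with
      | zero => simpa using he
      | succ i => simpa using hf.1 i
    · intro i j hij
      cases i using Fin.cases with
      | zero =>
        cases j using Fin.cases with
        | zero => exact absurd rfl hij
        | succ j => simpa using hef j
      | succ i =>
        cases j using Fin.cases with
        | zero => simpa using hfe i
        | succ j => simpa using hf.2 (by simpa using hij)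
    · intro i
      cases i using Fin.cases with
      | zero => simpa using heE
      | succ i =>
        have : f i * E = f i := by
          have := hfE i
          rwa [mul_sub, hfe, sub_zero] at this
        simpa using this
    · intro i
      cases i using Fin.cases with
      | zero => simpa using heq
      | succ i => simpa using hfq i

/-- Projections in a closed ideal act approximately as units on finitely many elements. -/
theorem HasRealRankZero.exists_approximating_projection (hC : HasRealRankZero C) (π : C →⋆ₐ[ℂ] B)
    {Q : C} (hQ : IsStarProjection Q) (S : Finset C) (hS : ∀ j ∈ S, π j = 0) {η : ℝ} (hη : 0 < η) :
    ∃ r, IsStarProjection r ∧ r * Q = r ∧ π r = 0 ∧ ∀ j ∈ S, ‖j * (Q - r)‖ ≤ η := by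
  let _ : PartialOrder C := CStarAlgebra.spectralOrder C
  have : StarOrderedRing C := CStarAlgebra.spectralOrderedRing C
  have hQ2 := hQ.isIdempotentElem.eq
  -- This element of the kernel dominates every star j * j, so one projection serves all of S.
  set w := ∑ j ∈ S, star j * j with hw
  have hwsa : IsSelfAdjoint w := by
    rw [IsSelfAdjoint, hw, star_sum]
    simp
  -- The squared norm is bounded below by 2t = η². One t is the spectral cut, the other the
  -- perturbation making the cut possible.
  set t := η ^ 2 / 2 with ht
  have ht0 : 0 < t := by positivity
  obtain ⟨c, hc, hcu, hcQ, hcn⟩ := hC.exists_isUnit_near hQ (hwsa.conjugate_proj hQ)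
    (hQ.conjugate_idem w) ht0.ne' ht0
  have hr0 := isStarProjection_posProj hcu
  have hrQ := commute_posProj hc hcQ
  refine ⟨posProj c * Q, hr0.mul_of_commute hQ hrQ, by rw [mul_assoc, hQ2], ?_, ?_⟩
  · have h1 : ‖π c + algebraMap ℝ B t‖ < t := by
      have h2 : π c + algebraMap ℝ B t = π (c - (Q * w * Q - algebraMap ℝ C t)) := by
        have h3 : π (algebraMap ℝ C t) = algebraMap ℝ B t := by
          rw [IsScalarTower.algebraMap_apply ℝ ℂ C, IsScalarTower.algebraMap_apply ℝ ℂ B,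
            AlgHomClass.commutes]
        have h4 : π w = 0 := by
          rw [hw, map_sum]
          exact Finset.sum_eq_zero fun j hj => by rw [map_mul, hS j hj, mul_zero]
        rw [map_sub, map_sub, h3, map_mul, map_mul, h4]
        simp
      rw [h2]
      exact (NonUnitalStarAlgHom.norm_apply_le π _).trans_lt hcn
    rw [map_mul, map_posProj π hc hcu, posProj_eq_zero h1, zero_mul]
  · intro j hj
    set s := 1 - posProj c with hs
    have hssa : IsSelfAdjoint s := hr0.one_sub.isSelfAdjoint
    have hsQ : Commute s Q := (Commute.one_left Q).sub_left hrQ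
    have hG : Q - posProj c * Q = s * Q := by rw [hs, sub_mul, one_mul]
    have hGP : IsStarProjection (s * Q) := hr0.one_sub.mul_of_commute hQ hsQ
    -- Since Q w Q ≤ c + 2t and the compression of c by s is nonpositive, only 2t survives.
    have h1 : s * (Q * w * Q) * s ≤ algebraMap ℝ C (2 * t) := by
      have h2 : Q * w * Q ≤ c + algebraMap ℝ C (2 * t) := by
        have h3 : IsSelfAdjoint (-(c - (Q * w * Q - algebraMap ℝ C t))) :=
          (hc.sub ((hwsa.conjugate_proj hQ).sub (.algebraMap C (.all _)))).neg
        have h4 := h3.le_algebraMap_norm_self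
        rw [norm_neg] at h4
        have h5 : algebraMap ℝ C ‖c - (Q * w * Q - algebraMap ℝ C t)‖ ≤ algebraMap ℝ C t :=
          algebraMap_mono C hcn.le
        have h6 := h4.trans h5
        rw [two_mul, map_add]
        have h7 : Q * w * Q = -(c - (Q * w * Q - algebraMap ℝ C t)) + (c + algebraMap ℝ C t) := by
          abel
        rw [h7]
        calc _ ≤ algebraMap ℝ C t + (c + algebraMap ℝ C t) := by gcongr
          _ = _ := by abel
      have h8 := hssa.conjugate_le_conjugate h2
      refine h8.trans ?_
      rw [mul_add, add_mul]
      have h9 : s * algebraMap ℝ C (2 * t) * s ≤ algebraMap ℝ C (2 * t) := by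
        rw [← Algebra.commutes, mul_assoc, hr0.one_sub.isIdempotentElem.eq,
          Algebra.algebraMap_eq_smul_one, smul_mul_assoc, one_mul]
        refine smul_le_smul_of_nonneg_left ?_ (by positivity)
        rw [sub_le_self_iff]
        exact hr0.nonneg
      calc _ ≤ 0 + algebraMap ℝ C (2 * t) := add_le_add (compress_posProj_nonpos hc hcu) h9
        _ = _ := zero_add _
    have h2 : star (j * (s * Q)) * (j * (s * Q)) ≤ algebraMap ℝ C (2 * t) := by
      refine le_trans ?_ h1
      have h3 : s * (Q * w * Q) * s = star (s * Q) * w * (s * Q) := by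
        rw [hGP.isSelfAdjoint.star_eq]
        nth_rw 2 [hsQ.eq]
        simp only [mul_assoc]
      rw [h3, star_mul, mul_assoc, ← mul_assoc (star j), ← mul_assoc]
      refine star_left_conjugate_le_conjugate ?_ _
      exact Finset.single_le_sum (f := fun j => star j * j) (fun i _ => star_mul_self_nonneg i) hj
    have h3 : ‖star (j * (s * Q)) * (j * (s * Q))‖ ≤ 2 * t :=
      (CStarAlgebra.norm_le_iff_le_algebraMap _ (by positivity)
        (star_mul_self_nonneg _)).2 h2
    rw [CStarRing.norm_star_mul_self] at h3
    rw [hG]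
    refine abs_le_of_sq_le_sq' ?_ hη.le |>.2
    rw [sq]
    linarith

end Lifting

/-! ### Splitting off an almost commuting projection in the kernel. -/

section Refinement

open scoped CStarAlgebra

variable {C B : Type*} [CStarAlgebra C] [CStarAlgebra B]

theorem norm_mul_mul_le_of_norm_le_one {a b x : C} {t : ℝ} (ha : ‖a‖ ≤ 1) (hb : ‖b‖ ≤ 1)
    (hx : ‖x‖ ≤ t) : ‖a * x * b‖ ≤ t :=
  calc ‖a * x * b‖ ≤ ‖a‖ * ‖x‖ * ‖b‖ := norm_mul₃_le
    _ ≤ 1 * t * 1 := by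
      have := (norm_nonneg _).trans hx
      gcongr
    _ = t := by ring

/-- Suppose that `E Ψ E` is, modulo the kernel of `π`, close to a diagonal element. Then `E` splits
into a projection `e` in the kernel that nearly commutes with `Ψ` and a sum of projections
on which `Ψ` is nearly diagonal. -/
theorem HasRealRankZero.exists_diagonal_splitting (hC : HasRealRankZero C) {π : C →⋆ₐ[ℂ] B}
    (hπ : Function.Surjective π) {E : C} (hE : IsStarProjection E) {α : Type*} {F : Set α}
    (hF : F.Finite) (Ψ : α → C) {m : ℕ} (q : Fin m → B) (hq : IsOrthogonalProjections q)
    (hqE : ∑ l, q l = π E) (lam : α → Fin m → ℂ) {ε δ : ℝ} (hε : 0 < ε)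
    (happ : ∀ f ∈ F, ‖π (E * Ψ f * E) - ∑ l, lam f l • q l‖ < ε)
    (hcomm : ∀ f ∈ F, ‖Ψ f * E - E * Ψ f‖ < δ) :
    ∃ (G : Fin m → C) (e : C), IsOrthogonalProjections G ∧ (∀ l, e * G l = 0) ∧
      IsStarProjection e ∧ π e = 0 ∧ e + ∑ l, G l = E ∧
      (∀ f ∈ F, ‖Ψ f * e - e * Ψ f‖ < 4 * ε + 2 * δ) ∧
      ∀ f ∈ F, ‖E * Ψ f * E - (e * Ψ f * e + ∑ l, lam f l • G l)‖ < 6 * ε := by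
  classical
  have hqE' : ∀ i, q i * π E = q i := fun i => by
    rw [← hqE, Finset.mul_sum, Finset.sum_eq_single i]
    · exact (hq.1 i).isIdempotentElem.eq
    · intro j _ hj
      exact hq.2 hj.symm
    · simp
  obtain ⟨Q, hQ, hQE, hQq⟩ := hC.exists_lift_projections hπ m hE q hq hqE'
  set T : α → C := fun f => E * Ψ f * E - ∑ l, lam f l • Q l with hT
  have hπT : ∀ f, π (T f) = π (E * Ψ f * E) - ∑ l, lam f l • q l := fun f => by
    simp only [hT, map_sub, map_sum, map_smul, hQq]
  -- The error T is corrected by a lift of its image of norm below ε; the difference J lies in the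
  -- kernel.
  choose x hx hxn using fun f => exists_lift_norm_le hπ (π (T f))
  set J : α → C := fun f => T f - x f with hJ
  have hπJ : ∀ f, π (J f) = 0 := fun f => by simp only [hJ, map_sub, hx, sub_self]
  -- Adjoints are included because the estimate for S is one-sided, and both J g and g J must be
  -- small.
  set S : Finset C := hF.toFinset.image J ∪ hF.toFinset.image (fun f => star (J f)) with hS
  have hS0 : ∀ j ∈ S, π j = 0 := by
    intro j hj
    rw [hS, Finset.mem_union, Finset.mem_image, Finset.mem_image] at hj
    rcases hj with ⟨f, -, rfl⟩ | ⟨f, -, rfl⟩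
    · exact hπJ f
    · rw [map_star, hπJ, star_zero]
  -- The m estimates add up to at most ε, and m = 0 is allowed.
  set η : ℝ := ε / (m + 1) with hη
  have hη0 : 0 < η := by positivity
  choose r hr hrQ hπr hrS using fun l =>
    hC.exists_approximating_projection π (hQ.1 l) S hS0 hη0
  have hQr : ∀ l, Q l * r l = r l := fun l => by
    have := congrArg star (hrQ l)
    rwa [star_mul, (hQ.1 l).isSelfAdjoint.star_eq, (hr l).isSelfAdjoint.star_eq] at this
  set G : Fin m → C := fun l => Q l - r l with hG
  have hGp : ∀ l, IsStarProjection (G l) := fun l => (hr l).sub_of_mul_eq_left (hQ.1 l) (hrQ l)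
  have hGQ : ∀ l, G l * Q l = G l := fun l => by
    simp only [hG, sub_mul, hrQ, (hQ.1 l).isIdempotentElem.eq]
  have hQG : ∀ l, Q l * G l = G l := fun l => by
    simp only [hG, mul_sub, hQr, (hQ.1 l).isIdempotentElem.eq]
  have hGorth : IsOrthogonalProjections G := by
    refine ⟨hGp, fun i j hij => ?_⟩
    show G i * G j = 0
    rw [← hGQ i, ← hQG j, mul_assoc, ← mul_assoc (Q i), hQ.2 hij]
    simp
  have hGE : ∀ l, G l * E = G l := fun l => by rw [← hGQ, mul_assoc, hQE]
  set g := ∑ l, G l with hg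
  have hgp : IsStarProjection g := hGorth.sum _
  have hgE : g * E = g := by rw [hg, Finset.sum_mul]; simp only [hGE]
  have hEg : E * g = g := by
    have := congrArg star hgE
    rwa [star_mul, hE.isSelfAdjoint.star_eq, hgp.isSelfAdjoint.star_eq] at this
  obtain ⟨e, he⟩ : ∃ e, e = E - g := ⟨_, rfl⟩
  have hep : IsStarProjection e := he ▸ hgp.sub_of_mul_eq_left hE hgE
  have heg : e * g = 0 := by rw [he, sub_mul, hEg, hgp.isIdempotentElem.eq, sub_self]
  have hge : g * e = 0 := by rw [he, mul_sub, hgE, hgp.isIdempotentElem.eq, sub_self]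
  have hgG : ∀ l, g * G l = G l := fun l => by
    rw [hg, Finset.sum_mul, Finset.sum_eq_single l]
    · exact (hGp l).isIdempotentElem.eq
    · intro j _ hj
      exact hGorth.2 hj
    · simp
  have heG : ∀ l, e * G l = 0 := fun l => by rw [← hgG l, ← mul_assoc, heg, zero_mul]
  have hGe : ∀ l, G l * e = 0 := fun l => by
    have := congrArg star (heG l)
    rwa [star_mul, hep.isSelfAdjoint.star_eq, (hGp l).isSelfAdjoint.star_eq, star_zero] at this
  have hsum : e + g = E := by rw [he]; abel
  have hEe : E * e = e := by rw [← hsum, add_mul, hep.isIdempotentElem.eq, hge, add_zero]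
  have heE : e * E = e := by rw [← hsum, mul_add, hep.isIdempotentElem.eq, heg, add_zero]
  have hen := hep.norm_le_one
  have hgn := hgp.norm_le_one
  have hJg : ∀ j ∈ S, ‖j * g‖ ≤ ε := fun j hj => by
    rw [hg, Finset.mul_sum]
    calc ‖∑ l, j * G l‖ ≤ ∑ l : Fin m, η := norm_sum_le_of_le _ fun l _ => hrS l j hj
      _ = m * η := by simp
      _ ≤ (m + 1) * η := by gcongr; linarith
      _ = ε := by rw [hη]; field_simp
  have hmem1 : ∀ f ∈ F, J f ∈ S := fun f hf =>
    Finset.mem_union_left _ (Finset.mem_image_of_mem _ (hF.mem_toFinset.2 hf))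
  have hmem2 : ∀ f ∈ F, star (J f) ∈ S := fun f hf =>
    Finset.mem_union_right _ (Finset.mem_image_of_mem (fun f => star (J f)) (hF.mem_toFinset.2 hf))
  have hxε : ∀ f ∈ F, ‖x f‖ < ε := fun f hf =>
    (hxn f).trans_lt (by rw [hπT]; exact happ f hf)
  have hTx : ∀ f, T f = x f + J f := fun f => by simp only [hJ]; abel
  have hTg : ∀ a : C, ‖a‖ ≤ 1 → ∀ f ∈ F, ‖a * T f * g‖ < 2 * ε := fun a ha f hf => by
    rw [hTx, mul_add, add_mul]
    have h1 : ‖a * x f * g‖ ≤ ‖x f‖ := norm_mul_mul_le_of_norm_le_one ha hgn le_rfl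
    have h2 : ‖a * (J f * g) * 1‖ ≤ ε :=
      norm_mul_mul_le_of_norm_le_one ha (IsStarProjection.one C).norm_le_one
        (hJg _ (hmem1 f hf))
    rw [mul_one, ← mul_assoc] at h2
    linarith [norm_add_le (a * x f * g) (a * J f * g), hxε f hf]
  have hgT : ∀ f ∈ F, ‖g * T f * e‖ < 2 * ε := fun f hf => by
    rw [hTx, mul_add, add_mul]
    have h1 : ‖g * x f * e‖ ≤ ‖x f‖ := norm_mul_mul_le_of_norm_le_one hgn hen le_rfl
    have h3 : ‖g * J f‖ ≤ ε := by
      rw [← norm_star, star_mul, hgp.isSelfAdjoint.star_eq]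
      exact hJg _ (hmem2 f hf)
    have h2 : ‖1 * (g * J f) * e‖ ≤ ε :=
      norm_mul_mul_le_of_norm_le_one (IsStarProjection.one C).norm_le_one hen h3
    rw [one_mul] at h2
    linarith [norm_add_le (g * x f * e) (g * J f * e), hxε f hf]
  have hQg : ∀ l, Q l * g = G l := fun l => by
    rw [hg, Finset.mul_sum, Finset.sum_eq_single l]
    · exact hQG l
    · intro j _ hj
      rw [← hQG j, ← mul_assoc, hQ.2 hj.symm, zero_mul]
    · simp
  have hgQ : ∀ l, g * Q l = G l := fun l => by
    have := congrArg star (hQg l)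
    rwa [star_mul, hgp.isSelfAdjoint.star_eq, (hGp l).isSelfAdjoint.star_eq,
      (hQ.1 l).isSelfAdjoint.star_eq] at this
  -- The diagonal part multiplied by g is a combination of the G l, which e annihilates, so this
  -- block equals e T g.
  have h1 : ∀ f ∈ F, ‖e * Ψ f * g‖ < 2 * ε := fun f hf => by
    convert hTg e hen f hf using 2
    simp only [hT, mul_sub, sub_mul, Finset.mul_sum, Finset.sum_mul, mul_smul_comm, smul_mul_assoc]
    simp only [mul_assoc, hQg, heG, smul_zero, Finset.sum_const_zero, sub_zero, hEg]
    rw [← mul_assoc e E, heE]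
  have h2 : ∀ f ∈ F, ‖g * Ψ f * e‖ < 2 * ε := fun f hf => by
    convert hgT f hf using 2
    simp only [hT, mul_sub, sub_mul, Finset.mul_sum, Finset.sum_mul, mul_smul_comm, smul_mul_assoc,
      hgQ, hGe, smul_zero, Finset.sum_const_zero, sub_zero]
    simp only [mul_assoc, hEe]
    rw [← mul_assoc g E, hgE]
  have h3 : ∀ f ∈ F, ‖g * Ψ f * g - ∑ l, lam f l • G l‖ < 2 * ε := fun f hf => by
    convert hTg g hgn f hf using 2
    simp only [hT, mul_sub, sub_mul, Finset.mul_sum, Finset.sum_mul, mul_smul_comm, smul_mul_assoc]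
    simp only [mul_assoc, hQg, hgG, hEg]
    rw [← mul_assoc g E, hgE]
  have hE1 := hE.one_sub.norm_le_one
  refine ⟨G, e, hGorth, heG, hep, ?_, hsum, fun f hf => ?_, fun f hf => ?_⟩
  · have : π g = ∑ l, q l := by
      rw [hg, map_sum]
      exact Finset.sum_congr rfl fun l _ => by rw [hG, map_sub, hQq, hπr, sub_zero]
    rw [he, map_sub, this, hqE, sub_self]
  · have h4 : ‖(1 - E) * (Ψ f * E - E * Ψ f) * e‖ ≤ ‖Ψ f * E - E * Ψ f‖ :=
      norm_mul_mul_le_of_norm_le_one hE1 hen le_rfl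
    have h5 : ‖e * (Ψ f * E - E * Ψ f) * (1 - E)‖ ≤ ‖Ψ f * E - E * Ψ f‖ :=
      norm_mul_mul_le_of_norm_le_one hen hE1 le_rfl
    -- Two blocks between e and g, each below 2ε, and two blocks leading out of E, each bounded by
    -- the commutator with E.
    have hdec : Ψ f * e - e * Ψ f = (g * Ψ f * e - e * Ψ f * g) +
        ((1 - E) * (Ψ f * E - E * Ψ f) * e + e * (Ψ f * E - E * Ψ f) * (1 - E)) := by
      have a1 : (1 - E) * (Ψ f * E - E * Ψ f) * e = Ψ f * e - E * Ψ f * e := by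
        have : (1 - E) * (Ψ f * E - E * Ψ f) * e =
            Ψ f * (E * e) - E * Ψ f * (E * e) - E * Ψ f * e + E * E * Ψ f * e := by
          simp only [mul_sub, sub_mul, one_mul, mul_assoc]; abel
        rw [this, hEe, hE.isIdempotentElem.eq]; abel
      have a2 : e * (Ψ f * E - E * Ψ f) * (1 - E) = e * Ψ f * E - e * Ψ f := by
        have : e * (Ψ f * E - E * Ψ f) * (1 - E) =
            e * Ψ f * E - e * Ψ f * (E * E) - e * E * Ψ f + e * E * Ψ f * E := by
          simp only [mul_sub, sub_mul, mul_one, mul_assoc]; abel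
        rw [this, heE, hE.isIdempotentElem.eq]; abel
      rw [a1, a2, ← hsum]
      simp only [add_mul, mul_add]
      abel
    rw [hdec]
    have h6 := norm_add_le (g * Ψ f * e - e * Ψ f * g)
      ((1 - E) * (Ψ f * E - E * Ψ f) * e + e * (Ψ f * E - E * Ψ f) * (1 - E))
    have h7 := norm_sub_le (g * Ψ f * e) (e * Ψ f * g)
    have h8 := norm_add_le ((1 - E) * (Ψ f * E - E * Ψ f) * e)
      (e * (Ψ f * E - E * Ψ f) * (1 - E))
    linarith [h1 f hf, h2 f hf, hcomm f hf]
  · have hdec : E * Ψ f * E - (e * Ψ f * e + ∑ l, lam f l • G l) =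
        (e * Ψ f * g + g * Ψ f * e) + (g * Ψ f * g - ∑ l, lam f l • G l) := by
      rw [← hsum]
      simp only [add_mul, mul_add]
      abel
    rw [hdec]
    linarith [h1 f hf, h2 f hf, h3 f hf, norm_add_le (e * Ψ f * g + g * Ψ f * e)
      (g * Ψ f * g - ∑ l, lam f l • G l), norm_add_le (e * Ψ f * g) (g * Ψ f * e)]

end Refinement

/-! ### Quotients by closed two-sided ideals are C*-algebras. -/

section Quotient

open scoped CStarAlgebra

variable {A : Type u} [CStarAlgebra A]

/-- Left ideals of a C⋆-algebra contain, for each of their elements, approximate right units. -/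
theorem Ideal.exists_right_unit_near (I : Ideal A) {j : A} (hj : j ∈ I) {ε : ℝ} (hε : 0 < ε) :
    ∃ u, u ∈ I ∧ IsSelfAdjoint u ∧ ‖1 - u‖ ≤ 1 ∧ ‖j * (1 - u)‖ ≤ ε := by
  let _ : PartialOrder A := CStarAlgebra.spectralOrder A
  have : StarOrderedRing A := CStarAlgebra.spectralOrderedRing A
  have hsa : IsSelfAdjoint (star j * j) := .star_mul_self j
  have hnn : ∀ t ∈ spectrum ℝ (star j * j), 0 ≤ t := fun t ht =>
    spectrum_nonneg_of_nonneg (star_mul_self_nonneg j) ht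
  -- With u = (j*j + s)⁻¹ j*j, the squared norm of j(1 - u) is at most the supremum of t s²/(t +
  -- s)², hence at most s. The absolute value only makes the functions continuous on the whole line.
  set s := ε ^ 2 with hs
  have hs0 : 0 < s := by positivity
  have hpos : ∀ t : ℝ, 0 < |t| + s := fun t => by positivity
  have hvc : Continuous fun t : ℝ => 1 / (|t| + s) :=
    continuous_const.div (by fun_prop) fun t => (hpos t).ne'
  have hgc : Continuous fun t : ℝ => 1 - 1 / (|t| + s) * t := by fun_prop
  have hu : cfc (fun t : ℝ => 1 / (|t| + s) * t) (star j * j) =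
      cfc (fun t : ℝ => 1 / (|t| + s)) (star j * j) * (star j * j) := by
    rw [cfc_mul _ _ _ hvc.continuousOn (by fun_prop), cfc_id' ℝ (star j * j)]
  have h1u : 1 - cfc (fun t : ℝ => 1 / (|t| + s) * t) (star j * j) =
      cfc (fun t : ℝ => 1 - 1 / (|t| + s) * t) (star j * j) := by
    rw [cfc_sub _ _ _ (by fun_prop) (by fun_prop), cfc_const_one ℝ (star j * j)]
  have hval : ∀ t : ℝ, 0 ≤ t → 1 - 1 / (|t| + s) * t = s / (t + s) := fun t ht => by
    rw [abs_of_nonneg ht]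
    field_simp
    ring
  refine ⟨cfc (fun t : ℝ => 1 / (|t| + s) * t) (star j * j), ?_, cfc_predicate _ _, ?_, ?_⟩
  · rw [hu, ← mul_assoc]
    exact I.mul_mem_left _ hj
  · rw [h1u]
    refine norm_cfc_le zero_le_one fun t ht => ?_
    have ht0 := hnn t ht
    rw [hval t ht0, Real.norm_eq_abs, abs_of_nonneg (by positivity), div_le_one (by positivity)]
    linarith
  · rw [h1u]
    have h1 : star (j * cfc (fun t : ℝ => 1 - 1 / (|t| + s) * t) (star j * j)) *
        (j * cfc (fun t : ℝ => 1 - 1 / (|t| + s) * t) (star j * j)) =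
        cfc (fun t : ℝ => (1 - 1 / (|t| + s) * t) * t * (1 - 1 / (|t| + s) * t)) (star j * j) := by
      rw [cfc_mul _ _ _ (by fun_prop) (by fun_prop), cfc_mul _ _ _ (by fun_prop) (by fun_prop),
        cfc_id' ℝ (star j * j), star_mul,
        (cfc_predicate (fun t : ℝ => 1 - 1 / (|t| + s) * t) (star j * j)).star_eq]
      simp only [mul_assoc]
    refine abs_le_of_sq_le_sq' ?_ hε.le |>.2
    rw [sq, ← CStarRing.norm_star_mul_self, h1, ← hs]
    refine norm_cfc_le hs0.le fun t ht => ?_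
    have ht0 := hnn t ht
    rw [hval t ht0, Real.norm_eq_abs, abs_of_nonneg (by positivity), div_mul_eq_mul_div,
      div_mul_div_comm, div_le_iff₀ (by positivity)]
    nlinarith [mul_nonneg ht0 ht0, mul_nonneg hs0.le (mul_nonneg ht0 ht0),
      mul_nonneg (mul_nonneg hs0.le hs0.le) ht0, mul_pos (mul_pos hs0 hs0) hs0]

/-- Closed two-sided ideals of a C⋆-algebra are self-adjoint. -/
theorem Ideal.star_mem_of_isClosed (I : Ideal A) [I.IsTwoSided] (hI : IsClosed (I : Set A)) {j : A}
    (hj : j ∈ I) : star j ∈ I := by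
  rw [← SetLike.mem_coe, ← hI.closure_eq, Metric.mem_closure_iff]
  intro ε hε
  obtain ⟨u, hu, husa, -, hun⟩ := I.exists_right_unit_near hj (half_pos hε)
  refine ⟨u * star j, I.mul_mem_right _ hu, ?_⟩
  have : star j - u * star j = star (j * (1 - u)) := by
    rw [star_mul, star_sub, star_one, husa.star_eq, sub_mul, one_mul]
  rw [dist_eq_norm, this, norm_star]
  linarith

/-- The quotient of a C⋆-algebra by a closed two-sided ideal is a C⋆-algebra. -/
noncomputable abbrev Ideal.quotientCStarAlgebra (I : Ideal A) [I.IsTwoSided]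
    (hI : IsClosed (I : Set A)) : CStarAlgebra (A ⧸ I) :=
  haveI : IsClosed (I : Set A) := hI
  letI nring : NormedRing (A ⧸ I) :=
    { Ideal.Quotient.ring I, Submodule.Quotient.normedAddCommGroup I with
      dist_eq := dist_eq_norm_neg_add
      norm_mul_le := fun x y => by
        refine le_of_forall_pos_le_add fun ε hε => ?_
        have h := ((Metric.nhds_basis_ball.prod_nhds Metric.nhds_basis_ball).tendsto_iff
          Metric.nhds_basis_ball).mp (continuous_mul.tendsto (‖x‖, ‖y‖)) ε hε
        simp only [Set.mem_prod, Metric.mem_ball, and_imp, Prod.forall, Prod.exists] at h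
        obtain ⟨ε₁, ε₂, ⟨h₁, h₂⟩, h⟩ := h
        obtain ⟨a, rfl, ha⟩ := Submodule.Quotient.norm_mk_lt x h₁
        obtain ⟨b, rfl, hb⟩ := Submodule.Quotient.norm_mk_lt y h₂
        simp only [dist, abs_sub_lt_iff] at h
        specialize h ‖a‖ ‖b‖ ⟨by linarith, by linarith [Submodule.Quotient.norm_mk_le I a]⟩
          ⟨by linarith, by linarith [Submodule.Quotient.norm_mk_le I b]⟩
        exact (Submodule.Quotient.norm_mk_le I (a * b)).trans ((norm_mul_le a b).trans
          (sub_lt_iff_lt_add'.mp h.1).le) }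
  letI nalg : NormedAlgebra ℂ (A ⧸ I) :=
    { Submodule.Quotient.normedSpace I ℂ, Ideal.Quotient.algebra ℂ with }
  letI sring : StarRing (A ⧸ I) :=
    { star := Quotient.map' star fun a b hab => by
        rw [Submodule.quotientRel_def] at hab ⊢
        rw [← star_sub]
        exact I.star_mem_of_isClosed hI hab
      star_involutive := by
        rintro ⟨a⟩
        exact congrArg (Ideal.Quotient.mk I) (star_star a)
      star_mul := by
        rintro ⟨a⟩ ⟨b⟩
        exact congrArg (Ideal.Quotient.mk I) (star_mul a b)
      star_add := by
        rintro ⟨a⟩ ⟨b⟩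
        exact congrArg (Ideal.Quotient.mk I) (star_add a b) }
  { nring, nalg, sring with
    toCompleteSpace := Submodule.Quotient.completeSpace I
    star_smul := by
      rintro c ⟨a⟩
      exact congrArg (Ideal.Quotient.mk I) (star_smul c a)
    norm_mul_self_le := by
      rintro ⟨a⟩
      refine le_of_forall_pos_le_add fun ε hε => ?_
      -- Take a representative b of the class of a*a with nearly minimal norm, and u almost a unit
      -- for b - a*a. Then a(1 - u) represents the class of a, and its squared norm exceeds ‖b‖ by
      -- at most ε/2.
      obtain ⟨b, hb, hbn⟩ := Submodule.Quotient.norm_mk_lt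
        (Ideal.Quotient.mk I (star a * a)) (half_pos hε)
      have hi : b - star a * a ∈ I := (Ideal.Quotient.eq (I := I)).1 hb
      obtain ⟨u, hu, husa, hu1, hun⟩ := I.exists_right_unit_near hi (half_pos hε)
      have h1 : ‖Ideal.Quotient.mk I a‖ ≤ ‖a * (1 - u)‖ := by
        have : Ideal.Quotient.mk I a = Ideal.Quotient.mk I (a * (1 - u)) := by
          rw [Ideal.Quotient.eq]
          have : a - a * (1 - u) = a * u := by rw [mul_sub, mul_one]; abel
          rw [this]
          exact I.mul_mem_left _ hu
        rw [this]
        exact Submodule.Quotient.norm_mk_le I _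
      have h2 : ‖a * (1 - u)‖ * ‖a * (1 - u)‖ ≤ ‖b‖ + ε / 2 := by
        rw [← CStarRing.norm_star_mul_self]
        have h3 : star (a * (1 - u)) * (a * (1 - u)) =
            (1 - u) * (b * (1 - u) - (b - star a * a) * (1 - u)) := by
          rw [star_mul, star_sub, star_one, husa.star_eq]
          simp only [mul_sub, sub_mul, mul_assoc, one_mul, mul_one]
          abel
        rw [h3]
        calc _ ≤ ‖1 - u‖ * (‖b‖ * ‖1 - u‖ + ‖(b - star a * a) * (1 - u)‖) :=
              (norm_mul_le _ _).trans (by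
                gcongr
                exact (norm_sub_le _ _).trans (by gcongr; exact norm_mul_le _ _))
          _ ≤ 1 * (‖b‖ * 1 + ε / 2) := by gcongr
          _ = _ := by ring
      have h4 : ‖Ideal.Quotient.mk I a‖ * ‖Ideal.Quotient.mk I a‖ ≤
          ‖Ideal.Quotient.mk I (star a * a)‖ + ε := by
        have := mul_le_mul h1 h1 (norm_nonneg _) (norm_nonneg _)
        linarith
      exact h4 }

/-- Only a surjection with the right kernel is used later. This lets the induction replace a
quotient by matrices over it. -/
theorem exists_quotient_cstarAlgebra (I : Ideal A) [I.IsTwoSided] (hI : IsClosed (I : Set A)) :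
    ∃ (B : Type u) (_ : CStarAlgebra B) (π : A →⋆ₐ[ℂ] B), Function.Surjective π ∧
      ∀ a, π a = 0 ↔ a ∈ I := by
  let _ := I.quotientCStarAlgebra hI
  refine ⟨A ⧸ I, inferInstance,
    { toFun := Ideal.Quotient.mk I
      map_one' := rfl
      map_mul' := fun _ _ => rfl
      map_zero' := rfl
      map_add' := fun _ _ => rfl
      commutes' := fun _ => rfl
      map_star' := fun _ => rfl }, Ideal.Quotient.mk_surjective, fun a => ?_⟩
  exact Ideal.Quotient.eq_zero_iff_mem

end Quotient

/-! ### Matrix algebras: block sums, entrywise maps, real rank zero. -/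

section Matrices

open scoped CStarAlgebra

variable {D B : Type*} {ι κ μ : Type*}

@[simp] theorem oplus_inl_inl [Zero D] (a : D) (M : CStarMatrix ι ι D) (x y : Unit) :
    oplus a M (Sum.inl x) (Sum.inl y) = a := rfl

@[simp] theorem oplus_inl_inr [Zero D] (a : D) (M : CStarMatrix ι ι D) (x : Unit) (y : ι) :
    oplus a M (Sum.inl x) (Sum.inr y) = 0 := rfl

@[simp] theorem oplus_inr_inl [Zero D] (a : D) (M : CStarMatrix ι ι D) (x : ι) (y : Unit) :
    oplus a M (Sum.inr x) (Sum.inl y) = 0 := rfl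

@[simp] theorem oplus_inr_inr [Zero D] (a : D) (M : CStarMatrix ι ι D) (x y : ι) :
    oplus a M (Sum.inr x) (Sum.inr y) = M x y := rfl

theorem oplus_add [AddZeroClass D] (a b : D) (M N : CStarMatrix ι ι D) :
    oplus a M + oplus b N = oplus (a + b) (M + N) := by
  ext (x | x) (y | y) <;> simp

theorem oplus_sub [AddGroup D] (a b : D) (M N : CStarMatrix ι ι D) :
    oplus a M - oplus b N = oplus (a - b) (M - N) := by
  ext (x | x) (y | y) <;> simp

theorem oplus_zero_zero [Zero D] : oplus (0 : D) (0 : CStarMatrix ι ι D) = 0 := by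
  ext (x | x) (y | y) <;> simp

theorem oplus_mul [NonUnitalNonAssocSemiring D] [Fintype ι] (a b : D) (M N : CStarMatrix ι ι D) :
    oplus a M * oplus b N = oplus (a * b) (M * N) := by
  ext (x | x) (y | y) <;> simp [CStarMatrix.mul_apply]

theorem oplus_star [AddMonoid D] [StarAddMonoid D] (a : D) (M : CStarMatrix ι ι D) :
    star (oplus a M) = oplus (star a) (star M) := by
  ext (x | x) (y | y) <;> simp [CStarMatrix.star_apply]

theorem oplus_smul [Semiring D] [Algebra ℂ D] (c : ℂ) (a : D) (M : CStarMatrix ι ι D) :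
    c • oplus a M = oplus (c • a) (c • M) := by
  ext (x | x) (y | y) <;> simp

theorem oplus_one [DecidableEq ι] [Zero D] [One D] :
    oplus (1 : D) (1 : CStarMatrix ι ι D) = 1 := by
  ext (x | x) (y | y)
  · simp
  · simp
  · simp
  · rw [oplus_inr_inr, CStarMatrix.one_apply, CStarMatrix.one_apply]
    simp

theorem oplus_zero_sum [AddCommMonoid D] {β : Type*} (s : Finset β) (M : β → CStarMatrix ι ι D) :
    oplus (0 : D) (∑ b ∈ s, M b) = ∑ b ∈ s, oplus (0 : D) (M b) := by
  classical
  induction s using Finset.induction_on with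
  | empty => simp [oplus_zero_zero]
  | insert a s ha ih => rw [Finset.sum_insert ha, Finset.sum_insert ha, ← ih, oplus_add, add_zero]

theorem scalarDiag_eq_oplus [DecidableEq ι] [Zero D] (a : D) :
    scalarDiag (Unit ⊕ ι) a = oplus a (scalarDiag ι a) := by
  ext (x | x) (y | y) <;> simp [scalarDiag, Matrix.diagonal_apply]

theorem mul_scalarDiag_apply [DecidableEq ι] [Fintype ι] [NonUnitalNonAssocSemiring D]
    (M : CStarMatrix ι ι D) (a : D) (i j : ι) : (M * scalarDiag ι a) i j = M i j * a := by
  rw [CStarMatrix.mul_apply, Finset.sum_eq_single j]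
  · simp [scalarDiag]
  · intro k _ hk
    simp [scalarDiag, hk]
  · simp

theorem isStarProjection_scalarDiag [DecidableEq ι] [Fintype ι] [Ring D] [StarRing D]
    {a : D} (ha : IsStarProjection a) : IsStarProjection (scalarDiag ι a) := by
  constructor
  · ext i j
    rw [mul_scalarDiag_apply]
    by_cases h : i = j
    · simp [scalarDiag, h, ha.isIdempotentElem.eq]
    · simp [scalarDiag, h]
  · ext i j
    rw [CStarMatrix.star_apply]
    by_cases h : i = j
    · simp [scalarDiag, h, ha.isSelfAdjoint.star_eq]
    · simp [scalarDiag, h, Ne.symm h]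

theorem IsStarProjection.oplus [Ring D] [StarRing D] [Fintype ι] {a : D} {M : CStarMatrix ι ι D}
    (ha : IsStarProjection a) (hM : IsStarProjection M) : IsStarProjection (oplus a M) := by
  constructor
  · rw [IsIdempotentElem, oplus_mul, ha.isIdempotentElem.eq, hM.isIdempotentElem.eq]
  · rw [IsSelfAdjoint, oplus_star, ha.isSelfAdjoint.star_eq, hM.isSelfAdjoint.star_eq]

/-- The embedding `a ↦ a ⊕ 0`. -/
def oplusHom (ι : Type*) (D : Type*) [CStarAlgebra D] [Fintype ι] :
    D →⋆ₙₐ[ℂ] CStarMatrix (Unit ⊕ ι) (Unit ⊕ ι) D where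
  toFun a := oplus a 0
  map_smul' c a := by simp [oplus_smul]
  map_zero' := oplus_zero_zero
  map_add' a b := by rw [oplus_add, add_zero]
  map_mul' a b := by rw [oplus_mul, mul_zero]
  map_star' a := by rw [oplus_star, star_zero]

@[simp] theorem oplusHom_apply [CStarAlgebra D] [Fintype ι] (a : D) :
    oplusHom ι D a = oplus a 0 := rfl

/-- Entrywise application of a unital homomorphism. -/
def matrixMapHom (ι : Type*) [CStarAlgebra D] [CStarAlgebra B] [Fintype ι] [DecidableEq ι]
    (π : D →⋆ₐ[ℂ] B) : CStarMatrix ι ι D →⋆ₐ[ℂ] CStarMatrix ι ι B where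
  toFun M := M.map π
  map_one' := by
    ext i j
    simp only [CStarMatrix.map_apply, CStarMatrix.one_apply]
    split_ifs <;> simp
  map_mul' M N := by
    ext i j
    simp [CStarMatrix.mul_apply]
  map_zero' := by ext i j; simp
  map_add' M N := by ext i j; simp
  commutes' c := by
    ext i j
    simp only [CStarMatrix.map_apply, CStarMatrix.algebraMap_apply]
    split_ifs
    · exact AlgHomClass.commutes π c
    · simp
  map_star' M := by ext i j; simp [CStarMatrix.star_apply, map_star]

@[simp] theorem matrixMapHom_apply [CStarAlgebra D] [CStarAlgebra B] [Fintype ι] [DecidableEq ι]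
    (π : D →⋆ₐ[ℂ] B) (M : CStarMatrix ι ι D) (i j : ι) :
    matrixMapHom ι π M i j = π (M i j) := rfl

theorem matrixMapHom_surjective [CStarAlgebra D] [CStarAlgebra B] [Fintype ι] [DecidableEq ι]
    {π : D →⋆ₐ[ℂ] B} (hπ : Function.Surjective π) :
    Function.Surjective (matrixMapHom ι π) := by
  intro M
  choose N hN using fun i j => hπ (M i j)
  exact ⟨CStarMatrix.ofMatrix (Matrix.of N), by ext i j; exact hN i j⟩

theorem matrixMapHom_injective [CStarAlgebra D] [CStarAlgebra B] [Fintype ι] [DecidableEq ι]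
    {π : D →⋆ₐ[ℂ] B} (hπ : ∀ d, π d = 0 → d = 0) (M : CStarMatrix ι ι D)
    (hM : matrixMapHom ι π M = 0) : M = 0 := by
  ext i j
  exact hπ _ (congrFun (congrFun hM i) j)

theorem matrixMapHom_oplus [CStarAlgebra D] [CStarAlgebra B] [Fintype ι] [DecidableEq ι]
    (π : D →⋆ₐ[ℂ] B) (a : D) (M : CStarMatrix ι ι D) :
    matrixMapHom (Unit ⊕ ι) π (oplus a M) = oplus (π a) (matrixMapHom ι π M) := by
  ext (x | x) (y | y) <;> simp

theorem matrixMapHom_scalarDiag [CStarAlgebra D] [CStarAlgebra B] [Fintype ι] [DecidableEq ι]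
    (π : D →⋆ₐ[ℂ] B) (a : D) : matrixMapHom ι π (scalarDiag ι a) = scalarDiag ι (π a) := by
  ext i j
  by_cases h : i = j <;> simp [scalarDiag, h]

/-- Matrices of matrices as matrices indexed by pairs. -/
def flattenHom [CStarAlgebra D] [Fintype ι] [Fintype κ] [Fintype μ] [DecidableEq μ]
    (e : κ ≃ ι × μ) :
    CStarMatrix ι ι (CStarMatrix μ μ D) →⋆ₙₐ[ℂ] CStarMatrix κ κ D where
  toFun M := CStarMatrix.ofMatrix (Matrix.of fun x y => M (e x).1 (e y).1 (e x).2 (e y).2)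
  map_smul' c M := by ext x y; simp
  map_zero' := by ext x y; simp
  map_add' M N := by ext x y; simp
  map_mul' M N := by
    ext x y
    have hsum : ∀ (s : Finset ι) (g : ι → CStarMatrix μ μ D) (i j : μ),
        (∑ k ∈ s, g k) i j = ∑ k ∈ s, g k i j := fun s g i j => by
      classical
      induction s using Finset.induction_on with
      | empty => simp
      | insert a s ha ih => rw [Finset.sum_insert ha, Finset.sum_insert ha, ← ih]; rfl
    simp only [CStarMatrix.ofMatrix_apply, Matrix.of_apply, CStarMatrix.mul_apply]
    rw [hsum]
    simp only [CStarMatrix.mul_apply]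
    rw [← Fintype.sum_prod_type', ← e.sum_comp]
  map_star' M := by ext x y; simp [CStarMatrix.star_apply]

@[simp] theorem flattenHom_apply [CStarAlgebra D] [Fintype ι] [Fintype κ] [Fintype μ]
    [DecidableEq μ] (e : κ ≃ ι × μ) (M : CStarMatrix ι ι (CStarMatrix μ μ D)) (x y : κ) :
    flattenHom e M x y = M (e x).1 (e y).1 (e x).2 (e y).2 := rfl

/-- The embedding of `D` as the entry `(i, i)`. -/
def entryHom (D : Type*) [CStarAlgebra D] [Fintype ι] [DecidableEq ι] (i : ι) :
    D →⋆ₙₐ[ℂ] CStarMatrix ι ι D where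
  toFun a := CStarMatrix.ofMatrix (Matrix.single i i a)
  map_smul' c a := congrArg CStarMatrix.ofMatrix (Matrix.smul_single c i i a).symm
  map_zero' := congrArg CStarMatrix.ofMatrix (Matrix.single_zero i i)
  map_add' a b := congrArg CStarMatrix.ofMatrix (Matrix.single_add i i a b)
  map_mul' _ _ := congrArg CStarMatrix.ofMatrix (Matrix.single_mul_single_same ..).symm
  map_star' a := congrArg CStarMatrix.ofMatrix (Matrix.conjTranspose_single i i a).symm

theorem cornerRealRankZero_entryHom_one [CStarAlgebra D] [PartialOrder D] [StarOrderedRing D]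
    [Fintype ι] [DecidableEq ι] (hD : HasRealRankZero D) (i : ι) :
    CornerRealRankZero (entryHom D i 1) := by
  intro a ha haE ε hε
  have hcut : ∀ a : CStarMatrix ι ι D,
      entryHom D i 1 * a * entryHom D i 1 = entryHom D i (a i i) := fun a => by
    refine congrArg CStarMatrix.ofMatrix ((Matrix.single_mul_mul_single i i i i 1 a 1).trans ?_)
    rw [one_mul, mul_one]
  rw [hcut] at haE
  have hai : IsSelfAdjoint (a i i) := by
    have := congrFun (congrFun ha.star_eq i) i
    rwa [CStarMatrix.star_apply] at this
  obtain ⟨b, hb, -, hba, hu⟩ := cornerRealRankZero_one_iff.2 hD (a i i) hai (by simp) ε hε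
  have hE1 : entryHom D i 1 * entryHom D i 1 = entryHom D i 1 := by rw [← map_mul, one_mul]
  refine ⟨entryHom D i b, hb.map _, ?_, ?_, ?_⟩
  · rw [← map_mul, ← map_mul, one_mul, mul_one]
  · rw [← haE, ← map_sub]
    exact (NonUnitalStarAlgHom.norm_apply_le _ _).trans_lt hba
  · rw [sub_self, add_zero] at hu
    obtain ⟨u, rfl⟩ := hu
    have h1 : ∀ x y : D, x * y = 1 → (entryHom D i x + (1 - entryHom D i 1)) *
        (entryHom D i y + (1 - entryHom D i 1)) = 1 := fun x y hxy => by
      simp only [add_mul, mul_add, mul_sub, sub_mul, ← map_mul, one_mul, mul_one, hxy]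
      abel
    exact ⟨⟨_, _, h1 _ _ u.mul_inv, h1 _ _ u.inv_mul⟩, rfl⟩

theorem sum_entryHom_one [CStarAlgebra D] [Fintype ι] [DecidableEq ι] :
    ∑ i : ι, entryHom D i 1 = 1 :=
  (map_sum (CStarMatrix.ofMatrixₗ (R := ℂ)) (fun i : ι => Matrix.single i i (1 : D))
    Finset.univ).symm.trans (congrArg CStarMatrix.ofMatrix Matrix.sum_single_one)

/-- The unit is the sum of the diagonal matrix units, whose corners are copies of D; the corners are
added one at a time. -/
theorem HasRealRankZero.cstarMatrix [CStarAlgebra D] [PartialOrder D] [StarOrderedRing D]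
    [Fintype ι] [DecidableEq ι] (hD : HasRealRankZero D) :
    HasRealRankZero (CStarMatrix ι ι D) := by
  have horth : IsOrthogonalProjections fun i : ι => entryHom D i 1 := by
    refine ⟨fun i => (IsStarProjection.one D).map _, fun i j hij => ?_⟩
    exact congrArg CStarMatrix.ofMatrix (Matrix.single_mul_single_of_ne _ _ _ _ hij _)
  have h : ∀ s : Finset ι, CornerRealRankZero (∑ i ∈ s, entryHom D i 1) := fun s => by
    induction s using Finset.induction_on with
    | empty =>
      intro a ha haE ε hε
      have : a = 0 := by rw [← haE]; simp
      exact ⟨0, .zero _, by simp, by simpa [this] using hε, by simp⟩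
    | insert i s hi ih =>
      rw [Finset.sum_insert hi]
      refine (cornerRealRankZero_entryHom_one hD i).add (horth.1 i) (horth.sum s) ?_ ih
      rw [Finset.mul_sum]
      exact Finset.sum_eq_zero fun j hj => horth.2 (by rintro rfl; exact hi hj)
  rw [← cornerRealRankZero_one_iff, ← sum_entryHom_one]
  exact h _

end Matrices

/-! ### Homomorphisms given by points and orthogonal projections. -/

section Evaluation

variable {X β C : Type*} [TopologicalSpace X] [Fintype β]

/-- The homomorphism `f ↦ ∑ f(ξ) p` given by points and mutually orthogonal projections. -/
noncomputable def evalSumHom [Ring C] [StarRing C] [Algebra ℂ C] [StarModule ℂ C] (ξ : β → X) {p : β → C}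
    (hp : IsOrthogonalProjections p) : C(X, ℂ) →⋆ₙₐ[ℂ] C where
  toFun f := ∑ b, f (ξ b) • p b
  map_smul' c f := by simp [Finset.smul_sum, mul_smul]
  map_zero' := by simp
  map_add' f g := by simp [add_smul, Finset.sum_add_distrib]
  map_mul' f g := by
    classical
    rw [Finset.sum_mul]
    refine Finset.sum_congr rfl fun b _ => ?_
    rw [Finset.mul_sum, Finset.sum_eq_single b]
    · rw [smul_mul_smul_comm, (hp.1 b).isIdempotentElem.eq]; rfl
    · intro c _ hc
      rw [smul_mul_smul_comm, hp.2 hc.symm, smul_zero]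
    · simp
  map_star' f := by
    rw [star_sum]
    refine Finset.sum_congr rfl fun b _ => ?_
    rw [star_smul, (hp.1 b).isSelfAdjoint.star_eq]; rfl

@[simp] theorem evalSumHom_apply [Ring C] [StarRing C] [Algebra ℂ C] [StarModule ℂ C] (ξ : β → X)
    {p : β → C} (hp : IsOrthogonalProjections p) (f : C(X, ℂ)) :
    evalSumHom ξ hp f = ∑ b, f (ξ b) • p b := rfl

theorem finiteDimensional_span_range_evalSumHom [Ring C] [StarRing C] [Algebra ℂ C]
    [StarModule ℂ C] (ξ : β → X) {p : β → C} (hp : IsOrthogonalProjections p) :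
    FiniteDimensional ℂ (Submodule.span ℂ (Set.range (evalSumHom ξ hp))) := by
  have : FiniteDimensional ℂ (Submodule.span ℂ (Set.range p)) :=
    FiniteDimensional.span_of_finite ℂ (Set.finite_range p)
  refine Submodule.finiteDimensional_of_le (S₂ := Submodule.span ℂ (Set.range p)) ?_
  rw [Submodule.span_le]
  rintro _ ⟨f, rfl⟩
  exact Submodule.sum_mem _ fun b _ =>
    Submodule.smul_mem _ _ (Submodule.subset_span ⟨b, rfl⟩)

end Evaluation

/-! ### One stage: applying condition D in a quotient. -/

section FirstStage

open scoped CStarAlgebra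

variable {X : Type v} [MetricSpace X] [CompactSpace X]

/-- Functions on Y extend to X by Tietze, and two extensions differ by a function vanishing on Y,
which ψ kills. -/
theorem exists_factor_restrict {Y : Set X} (hY : IsClosed Y) {B : Type*} [CStarAlgebra B]
    (ψ : C(X, ℂ) →⋆ₐ[ℂ] B) (hψ : ∀ g : C(X, ℂ), (∀ x ∈ Y, g x = 0) → ψ g = 0) :
    ∃ φ : C(Y, ℂ) →⋆ₐ[ℂ] B, ∀ f : C(X, ℂ), φ (f.restrict Y) = ψ f := by
  have hext : ∀ f : C(Y, ℂ), ∃ g : C(X, ℂ), g.restrict Y = f := fun f =>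
    ContinuousMap.exists_restrict_eq hY f
  have heq : ∀ f g : C(X, ℂ), f.restrict Y = g.restrict Y → ψ f = ψ g := fun f g h => by
    rw [← sub_eq_zero, ← map_sub]
    refine hψ _ fun x hx => ?_
    have := DFunLike.congr_fun h ⟨x, hx⟩
    simpa [sub_eq_zero] using this
  choose ext hext using hext
  exact ⟨{
    toFun := fun f => ψ (ext f)
    map_one' := by rw [← map_one ψ]; exact heq _ _ (by rw [hext]; rfl)
    map_mul' := fun f g => by
      rw [← map_mul]; exact heq _ _ (by
        rw [hext]; ext x
        exact congrArg₂ (· * ·) (DFunLike.congr_fun (hext f) x).symm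
          (DFunLike.congr_fun (hext g) x).symm)
    map_zero' := by rw [← map_zero ψ]; exact heq _ _ (by rw [hext]; rfl)
    map_add' := fun f g => by
      rw [← map_add]; exact heq _ _ (by
        rw [hext]; ext x
        exact congrArg₂ (· + ·) (DFunLike.congr_fun (hext f) x).symm
          (DFunLike.congr_fun (hext g) x).symm)
    commutes' := fun c => by
      rw [← AlgHomClass.commutes ψ]; exact heq _ _ (by rw [hext]; rfl)
    map_star' := fun f => by
      rw [← map_star]; exact heq _ _ (by
        rw [hext]; ext x
        exact congrArg star (DFunLike.congr_fun (hext f) x).symm) },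
    fun f => heq _ _ (hext _)⟩

variable {D : Type u} [CStarAlgebra D]

/-- The unital homomorphism `f ↦ φ f ⊕ (∑ f(ξ) p + f(x₀) (1 - ∑ p))`. -/
noncomputable def dilationHom {N m : ℕ} (φ : C(X, ℂ) →⋆ₐ[ℂ] D) (x₀ : X) (ξ : Fin m → X)
    {P : Fin m → CStarMatrix (Fin N) (Fin N) D} (hP : IsOrthogonalProjections P) :
    C(X, ℂ) →⋆ₐ[ℂ] CStarMatrix (Unit ⊕ Fin N) (Unit ⊕ Fin N) D where
  -- Filling the complement by evaluation at x₀ makes the map unital, as condition D requires. Since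
  -- x₀ lies in all the closed sets, vanishing conditions are preserved.
  toFun f := oplus (φ f) (evalSumHom ξ hP f + f x₀ • (1 - ∑ j, P j))
  map_one' := by
    rw [← oplus_one, map_one]
    congr 1
    simp
  map_mul' f g := by
    have h1 : ∀ f : C(X, ℂ), evalSumHom ξ hP f * (1 - ∑ j, P j) = 0 := fun f => by
      rw [evalSumHom_apply, Finset.sum_mul]
      refine Finset.sum_eq_zero fun j _ => ?_
      rw [smul_mul_assoc, mul_sub, mul_one, Finset.mul_sum, Finset.sum_eq_single j,
        (hP.1 j).isIdempotentElem.eq, sub_self, smul_zero]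
      · intro i _ hi
        exact hP.2 hi.symm
      · simp
    have h2 : ∀ f : C(X, ℂ), (1 - ∑ j, P j) * evalSumHom ξ hP f = 0 := fun f => by
      have := congrArg star (h1 (star f))
      rwa [star_mul, ← map_star, star_star, (hP.sum Finset.univ).one_sub.isSelfAdjoint.star_eq,
        star_zero] at this
    rw [oplus_mul, map_mul, map_mul, add_mul, mul_add, mul_add, mul_smul_comm, h1,
      smul_mul_assoc, h2, smul_mul_smul_comm, (hP.sum Finset.univ).one_sub.isIdempotentElem.eq]
    simp
  map_zero' := by
    rw [← oplus_zero_zero, map_zero, map_zero]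
    simp
  map_add' f g := by
    rw [oplus_add, map_add, map_add]
    congr 1
    simp only [ContinuousMap.add_apply, add_smul]
    abel
  commutes' c := by
    have h1 : ∀ f : C(X, ℂ), algebraMap ℂ C(X, ℂ) c = c • (1 : C(X, ℂ)) := fun _ =>
      Algebra.algebraMap_eq_smul_one c
    have h2 : algebraMap ℂ (CStarMatrix (Unit ⊕ Fin N) (Unit ⊕ Fin N) D) c = c • 1 :=
      Algebra.algebraMap_eq_smul_one c
    rw [h1 0, h2, ← oplus_one, oplus_smul, map_smul, map_smul, map_one]
    congr 1
    simp [smul_sub, Finset.smul_sum]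
  map_star' f := by
    rw [oplus_star, map_star, map_star, star_add, star_smul,
      (hP.sum Finset.univ).one_sub.isSelfAdjoint.star_eq]
    rfl

theorem dilationHom_apply {N m : ℕ} (φ : C(X, ℂ) →⋆ₐ[ℂ] D) (x₀ : X) (ξ : Fin m → X)
    {P : Fin m → CStarMatrix (Fin N) (Fin N) D} (hP : IsOrthogonalProjections P) (f : C(X, ℂ)) :
    dilationHom φ x₀ ξ hP f = oplus (φ f) (evalSumHom ξ hP f + f x₀ • (1 - ∑ j, P j)) := rfl

theorem mul_scalarDiag_of_mem_matricesOver {ι : Type*} [Fintype ι] [DecidableEq ι]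
    {p : D} (hp : IsStarProjection p) {M : CStarMatrix ι ι D}
    (hM : M ∈ matricesOver ι (cornerSet p)) : M * scalarDiag ι p = M := by
  ext i j
  rw [mul_scalarDiag_apply]
  obtain ⟨y, hy⟩ := hM i j
  rw [hy, mul_assoc, hp.isIdempotentElem.eq]

theorem mem_corner_of_mul_scalarDiag {ι : Type*} [Fintype ι] [DecidableEq ι]
    {p : D} {M : CStarMatrix ι ι D} (hM : M * scalarDiag ι p = M) (i j : ι) :
    M i j = M i j * p := by
  conv_lhs => rw [← hM]
  rw [mul_scalarDiag_apply]

/-- The summand at x₀ lives on the complement of ΣP and disappears. So the commutator with E ⊕ ΣP is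
that of φ with E. -/
theorem oplus_compress_dilationHom {N m : ℕ} (φ : C(X, ℂ) →⋆ₐ[ℂ] D) (x₀ : X) (ξ : Fin m → X)
    {P : Fin m → CStarMatrix (Fin N) (Fin N) D} (hP : IsOrthogonalProjections P) (E : D)
    (f : C(X, ℂ)) :
    dilationHom φ x₀ ξ hP f * oplus E (∑ j, P j) = oplus (φ f * E) (∑ j, f (ξ j) • P j) ∧
    oplus E (∑ j, P j) * dilationHom φ x₀ ξ hP f = oplus (E * φ f) (∑ j, f (ξ j) • P j) ∧
    oplus E (∑ j, P j) * dilationHom φ x₀ ξ hP f * oplus E (∑ j, P j) =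
      oplus (E * φ f * E) (∑ j, f (ξ j) • P j) := by
  have hs := hP.sum Finset.univ
  have h1 : (∑ j, f (ξ j) • P j) * ∑ j, P j = ∑ j, f (ξ j) • P j := by
    rw [Finset.sum_mul]
    refine Finset.sum_congr rfl fun j _ => ?_
    rw [smul_mul_assoc, Finset.mul_sum, Finset.sum_eq_single j, (hP.1 j).isIdempotentElem.eq]
    · intro i _ hi
      exact hP.2 hi.symm
    · simp
  have h2 : (∑ j, P j) * (∑ j, f (ξ j) • P j) = ∑ j, f (ξ j) • P j := by
    rw [Finset.mul_sum]
    refine Finset.sum_congr rfl fun j _ => ?_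
    rw [mul_smul_comm, Finset.sum_mul, Finset.sum_eq_single j, (hP.1 j).isIdempotentElem.eq]
    · intro i _ hi
      exact hP.2 hi
    · simp
  have h3 : (∑ j, P j) * (1 - ∑ j, P j) = 0 := hs.mul_one_sub_self
  have h4 : (1 - ∑ j, P j) * (∑ j, P j) = 0 := hs.one_sub_mul_self
  have h5 : oplus E (∑ j, P j) * dilationHom φ x₀ ξ hP f =
      oplus (E * φ f) (∑ j, f (ξ j) • P j) := by
    rw [dilationHom_apply, oplus_mul, mul_add, evalSumHom_apply, h2, mul_smul_comm, h3, smul_zero,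
      add_zero]
  refine ⟨?_, h5, ?_⟩
  · rw [dilationHom_apply, oplus_mul, add_mul, evalSumHom_apply, h1, smul_mul_assoc, h4, smul_zero,
      add_zero]
  · rw [h5, oplus_mul, h1]

/-- Condition D applies to the factorization through C(Y) in the quotient. The lifted P j need not
sum to the diagonal matrix of E, only their images do; therefore the projection to be split is E ⊕
ΣP. -/
theorem exists_splitting_of_conditionD {Y : Set X} (hY : IsClosed Y) (x₀ : X)
    {F : Set C(X, ℂ)} (hF : F.Finite)
    (hD : ConditionD.{u, v} Y ((fun f : C(X, ℂ) => f.restrict Y) '' F)) {ε : ℝ} (hε : 0 < ε) :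
    ∃ δ : ℝ, 0 < δ ∧ ∃ N : ℕ, 0 < N ∧
    ∀ (D : Type u) [CStarAlgebra D] [PartialOrder D] [StarOrderedRing D], HasRealRankZero D →
    ∀ (B : Type u) [CStarAlgebra B] (π : D →⋆ₐ[ℂ] B), Function.Surjective π →
    ∀ φ : C(X, ℂ) →⋆ₐ[ℂ] D, (∀ g : C(X, ℂ), (∀ x ∈ Y, g x = 0) → π (φ g) = 0) →
    ∀ E : D, IsStarProjection E → (∀ f ∈ F, ‖φ f * E - E * φ f‖ < δ) →
    ∃ (m r : ℕ) (ξ : Fin m → X) (lam : Fin r → X)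
      (P : Fin m → CStarMatrix (Fin N) (Fin N) D) (hP : IsOrthogonalProjections P)
      (G : Fin r → CStarMatrix (Unit ⊕ Fin N) (Unit ⊕ Fin N) D)
      (e : CStarMatrix (Unit ⊕ Fin N) (Unit ⊕ Fin N) D),
      (∀ j, ξ j ∈ Y) ∧ (∀ j, P j * scalarDiag (Fin N) E = P j) ∧
      IsOrthogonalProjections G ∧ (∀ l, e * G l = 0) ∧ IsStarProjection e ∧
      matrixMapHom (Unit ⊕ Fin N) π e = 0 ∧ e + ∑ l, G l = oplus E (∑ j, P j) ∧
      (∀ f ∈ F, ‖dilationHom φ x₀ ξ hP f * e - e * dilationHom φ x₀ ξ hP f‖ < ε) ∧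
      ∀ f ∈ F, ‖oplus (E * φ f * E) (∑ j, f (ξ j) • P j) -
        (e * dilationHom φ x₀ ξ hP f * e + ∑ l, f (lam l) • G l)‖ < ε := by
  obtain ⟨δ₀, hδ₀, N, hN, h⟩ := hD (ε / 8) (by positivity)
  -- With ε/8 and ε/4 in the splitting lemma, the commutator bound is 4(ε/8) + 2(ε/4) = ε and the
  -- approximation bound 6(ε/8) < ε.
  refine ⟨min δ₀ (ε / 4), by positivity, N, hN, ?_⟩
  intro D _ _ _ hD0 B _ π hπ φ hφ E hE hcomm
  let _ : PartialOrder B := CStarAlgebra.spectralOrder B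
  have : StarOrderedRing B := CStarAlgebra.spectralOrderedRing B
  obtain ⟨ψ, hψ⟩ := exists_factor_restrict hY (π.comp φ) hφ
  have hpE : IsStarProjection (π E) := hE.map π
  obtain ⟨m, r, ξ, lam, P', Q', hP', hP'E, hQ', hQ'E, hP's, hQ's, happ⟩ := h B ψ (π E) hpE (by
    rintro _ ⟨f, hf, rfl⟩
    show ‖π E * ψ (f.restrict Y) - ψ (f.restrict Y) * π E‖ < δ₀
    rw [hψ, norm_sub_rev]
    show ‖π (φ f) * π E - π E * π (φ f)‖ < δ₀
    rw [← map_mul, ← map_mul, ← map_sub]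
    exact (NonUnitalStarAlgHom.norm_apply_le π _).trans_lt
      ((hcomm f hf).trans_le (min_le_left _ _)))
  have hRN : HasRealRankZero (CStarMatrix (Fin N) (Fin N) D) := hD0.cstarMatrix
  have hRN1 : HasRealRankZero (CStarMatrix (Unit ⊕ Fin N) (Unit ⊕ Fin N) D) := hD0.cstarMatrix
  obtain ⟨P, hP, hPE, hPP'⟩ := hRN.exists_lift_projections
    (π := matrixMapHom (Fin N) π) (matrixMapHom_surjective hπ) m
    (isStarProjection_scalarDiag hE) P' hP' (fun i => by
      rw [matrixMapHom_scalarDiag]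
      exact mul_scalarDiag_of_mem_matricesOver hpE (hP'E i))
  have hE' : IsStarProjection (oplus E (∑ j, P j)) := hE.oplus (hP.sum _)
  have hπsum : matrixMapHom (Fin N) π (∑ j, P j) = scalarDiag (Fin N) (π E) := by
    rw [map_sum, ← hP's]
    exact Finset.sum_congr rfl fun j _ => hPP' j
  obtain ⟨G, e, hG, heG, he, hπe, hsum, hc, ha⟩ := hRN1.exists_diagonal_splitting
    (π := matrixMapHom (Unit ⊕ Fin N) π) (matrixMapHom_surjective hπ) hE' hF
    (fun f => dilationHom φ x₀ (fun j => (ξ j : X)) hP f) Q' hQ'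
    (by rw [hQ's, matrixMapHom_oplus, hπsum, scalarDiag_eq_oplus])
    (fun f l => f (lam l)) (ε := ε / 8) (δ := ε / 4) (by positivity)
    (fun f hf => by
      have h1 := happ _ ⟨f, hf, rfl⟩
      dsimp only at h1
      rw [hψ] at h1
      rw [(oplus_compress_dilationHom φ x₀ _ hP E f).2.2, matrixMapHom_oplus, map_sum]
      have h2 : ∑ j, matrixMapHom (Fin N) π (f (ξ j) • P j) = ∑ j, f (ξ j) • P' j :=
        Finset.sum_congr rfl fun j _ => by rw [map_smul, hPP']
      rw [h2, map_mul, map_mul]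
      exact h1)
    (fun f hf => by
      obtain ⟨h1, h2, -⟩ := oplus_compress_dilationHom φ x₀ (fun j => (ξ j : X)) hP E f
      rw [h1, h2, oplus_sub, sub_self]
      exact (NonUnitalStarAlgHom.norm_apply_le (oplusHom (Fin N) D) _).trans_lt
        ((hcomm f hf).trans_le (min_le_right _ _)))
  refine ⟨m, r, fun j => ξ j, fun l => lam l, P, hP, G, e, fun j => (ξ j).2, hPE, hG, heG, he, hπe,
    hsum, fun f hf => (hc f hf).trans_le (by linarith), fun f hf => ?_⟩
  have h1 := ha f hf
  rw [(oplus_compress_dilationHom φ x₀ _ hP E f).2.2] at h1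
  linarith

end FirstStage

/-! ### Gluing the stages and the induction along the chain. -/

section Dilation

open scoped CStarAlgebra

variable {X : Type v} [MetricSpace X]

/-- The block of the index set `Unit ⊕ κ` to which an index belongs, where `c` partitions `κ`. -/
def blockIndex {κ σ : Type*} (c : κ → σ) : Unit ⊕ κ → Option σ :=
  Sum.elim (fun _ => none) fun i => some (c i)

/-- The compression `E φ E` is, up to `ε` on `F`, diagonal after adding diagonal
blocks, where the block number `k` has spectrum in `K k` and entries in the kernel of
`π k.castSucc`. All blocks are contained in one algebra of matrices, with index set
`Unit ⊕ κ`. -/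
def HasDiagonalDilation {D : Type u} [CStarAlgebra D] [PartialOrder D] [StarOrderedRing D] {n : ℕ}
    (K : Fin n → Set X) (F : Set C(X, ℂ)) {B : Fin (n + 1) → Type u} [∀ k, CStarAlgebra (B k)]
    (π : ∀ k, D →⋆ₐ[ℂ] B k) (φ : C(X, ℂ) →⋆ₐ[ℂ] D) (E : D) (ε : ℝ) : Prop :=
  ∃ (κ : Type) (_ : Fintype κ) (_ : DecidableEq κ) (c : κ → Fin n)
    (β : Type) (_ : Fintype β) (lev : β → Fin n) (ξ : β → X)
    (P : β → CStarMatrix (Unit ⊕ κ) (Unit ⊕ κ) D)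
    (γ : Type) (_ : Fintype γ) (ζ : γ → X) (Q : γ → CStarMatrix (Unit ⊕ κ) (Unit ⊕ κ) D),
    Function.Surjective c ∧ IsOrthogonalProjections P ∧
    (∀ b x y, P b x y ≠ 0 → blockIndex c x = some (lev b) ∧ blockIndex c y = some (lev b)) ∧
    (∀ b x y, π (lev b).castSucc (P b x y) = 0) ∧ (∀ b, ξ b ∈ K (lev b)) ∧
    IsOrthogonalProjections Q ∧ oplus E 0 + ∑ b, P b = ∑ i, Q i ∧
    ∀ f ∈ F, ‖oplus (E * φ f * E) 0 + ∑ b, f (ξ b) • P b - ∑ i, f (ζ i) • Q i‖ < ε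

theorem hasDiagonalDilation_zero {D : Type u} [CStarAlgebra D] [PartialOrder D]
    [StarOrderedRing D] (K : Fin 0 → Set X) (F : Set C(X, ℂ)) {B : Fin 1 → Type u}
    [∀ k, CStarAlgebra (B k)] (π : ∀ k, D →⋆ₐ[ℂ] B k) (φ : C(X, ℂ) →⋆ₐ[ℂ] D) {ε : ℝ} (hε : 0 < ε) :
    HasDiagonalDilation K F π φ 0 ε :=
  ⟨Empty, inferInstance, inferInstance, Empty.elim, Empty, inferInstance, Empty.elim, Empty.elim,
    Empty.elim, Empty, inferInstance, Empty.elim, Empty.elim, fun k => k.elim0,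
    ⟨fun b => b.elim, fun b => b.elim⟩, fun b => b.elim, fun b => b.elim, fun b => b.elim,
    ⟨fun b => b.elim, fun b => b.elim⟩, by simp [oplus_zero_zero],
    fun f _ => by simpa [oplus_zero_zero] using hε⟩

variable [CompactSpace X]

theorem oplus_zero_mul_eq_zero {D ι : Type*} [NonUnitalNonAssocSemiring D] [Fintype ι] (a : D)
    {M : CStarMatrix (Unit ⊕ ι) (Unit ⊕ ι) D} (hM : ∀ x y, M (Sum.inl x) y = 0) :
    oplus a 0 * M = 0 := by
  ext (x | x) y <;> simp [CStarMatrix.mul_apply, hM]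

/-- The index set of the combined dilation of two stages. -/
def stageIndexEquiv (κ μ : Type*) :
    Unit ⊕ (μ ⊕ κ × (Unit ⊕ μ)) ≃ (Unit ⊕ κ) × (Unit ⊕ μ) where
  toFun := Sum.elim (fun _ => (Sum.inl (), Sum.inl ()))
    (Sum.elim (fun i => (Sum.inl (), Sum.inr i)) fun p => (Sum.inr p.1, p.2))
  invFun p := Sum.elim (fun _ => Sum.elim (fun _ => Sum.inl ()) (fun i => Sum.inr (Sum.inl i)) p.2)
    (fun a => Sum.inr (Sum.inr (a, p.2))) p.1
  left_inv := by rintro (x | x | ⟨x, y⟩) <;> rfl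
  right_inv := by rintro ⟨x | x, y | y⟩ <;> rfl

theorem IsOrthogonalProjections.sumElim {R β γ : Type*} [Ring R] [StarRing R] {p : β → R}
    {q : γ → R} (hp : IsOrthogonalProjections p) (hq : IsOrthogonalProjections q)
    (h : ∀ b c, p b * q c = 0) : IsOrthogonalProjections (Sum.elim p q) := by
  refine ⟨?_, ?_⟩
  · rintro (b | c)
    · exact hp.1 b
    · exact hq.1 c
  · rintro (b | b) (c | c) hbc
    · exact hp.2 (by simpa using hbc)
    · exact h b c
    · have := congrArg star (h c b)
      rwa [star_mul, (hp.1 c).isSelfAdjoint.star_eq, (hq.1 b).isSelfAdjoint.star_eq,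
        star_zero] at this
    · exact hq.2 (by simpa using hbc)

theorem IsOrthogonalProjections.map {R S β G : Type*} [Ring R] [StarRing R] [Ring S]
    [StarRing S] [FunLike G R S] [MulHomClass G R S] [StarHomClass G R S] [ZeroHomClass G R S]
    {p : β → R} (hp : IsOrthogonalProjections p)
    (θ : G) : IsOrthogonalProjections fun b => θ (p b) :=
  ⟨fun b => (hp.1 b).map θ, fun b c hbc => by
    show θ (p b) * θ (p c) = 0
    rw [← map_mul, hp.2 hbc, map_zero]⟩

theorem IsOrthogonalProjections.sum_mul {R β : Type*} [Ring R] [StarRing R] [Fintype β]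
    {p : β → R} (hp : IsOrthogonalProjections p) (b : β) : (∑ c, p c) * p b = p b := by
  classical
  rw [Finset.sum_mul, Finset.sum_eq_single b, (hp.1 b).isIdempotentElem.eq]
  · intro c _ hc
    exact hp.2 hc
  · simp

/-- E ⊕ ΣP splits as e + ΣG, and e has a dilation over the matrix algebra. Flattening matrices of
matrices puts ΣP in a new block of level 0 and raises the other levels by one; the G l join the
projections that diagonalize e. -/
theorem hasDiagonalDilation_succ {n : ℕ} {K : Fin (n + 1) → Set X} {F : Set C(X, ℂ)} {x₀ : X}
    {D : Type u} [CStarAlgebra D] [PartialOrder D] [StarOrderedRing D]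
    {B : Fin (n + 2) → Type u} [∀ k, CStarAlgebra (B k)] [∀ k, PartialOrder (B k)]
    [∀ k, StarOrderedRing (B k)] {π : ∀ k, D →⋆ₐ[ℂ] B k}
    {φ : C(X, ℂ) →⋆ₐ[ℂ] D} {E : D} {ε₁ ε₂ : ℝ} {N : ℕ} (hN : 0 < N) {m r : ℕ}
    {ξ : Fin m → X} {lam : Fin r → X} {P : Fin m → CStarMatrix (Fin N) (Fin N) D}
    (hP : IsOrthogonalProjections P)
    {G : Fin r → CStarMatrix (Unit ⊕ Fin N) (Unit ⊕ Fin N) D}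
    {e : CStarMatrix (Unit ⊕ Fin N) (Unit ⊕ Fin N) D} (hξ : ∀ j, ξ j ∈ K 0)
    (hPE : ∀ j x y, π 0 (P j x y) = 0)
    (hG : IsOrthogonalProjections G) (heG : ∀ l, e * G l = 0) (he : IsStarProjection e)
    (hsum : e + ∑ l, G l = oplus E (∑ j, P j))
    (happ : ∀ f ∈ F, ‖oplus (E * φ f * E) (∑ j, f (ξ j) • P j) -
        (e * dilationHom φ x₀ ξ hP f * e + ∑ l, f (lam l) • G l)‖ < ε₁)
    (hdil : HasDiagonalDilation (fun k => K k.succ) F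
      (fun k => matrixMapHom (Unit ⊕ Fin N) (π k.succ)) (dilationHom φ x₀ ξ hP) e ε₂) :
    HasDiagonalDilation K F π φ E (ε₁ + ε₂) := by
  obtain ⟨κ, _, _, c, β, _, lev, ξ', P', γ, _, ζ, Q', hc, hP', hblock, hker, hξ', hQ', hsum',
    happ'⟩ := hdil
  set θ := flattenHom (D := D) (stageIndexEquiv κ (Fin N)) with hθ
  set ι := oplusHom κ (CStarMatrix (Unit ⊕ Fin N) (Unit ⊕ Fin N) D) with hι
  have hP'inl : ∀ b x y, P' b (Sum.inl x) y = 0 := fun b x y => by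
    by_contra h
    exact absurd (hblock b _ _ h).1 (by simp [blockIndex])
  have hιP' : ∀ a b, ι a * P' b = 0 := fun a b => oplus_zero_mul_eq_zero a (hP'inl b)
  have hGe : ∀ l, G l * e = 0 := fun l => by
    have := congrArg star (heG l)
    rwa [star_mul, (hG.1 l).isSelfAdjoint.star_eq, he.isSelfAdjoint.star_eq, star_zero] at this
  -- The Q' i lie below e ⊕ 0 + ΣP'; G l is orthogonal to e, and the P' b vanish on the first row.
  have hGQ' : ∀ l i, ι (G l) * Q' i = 0 := fun l i => by
    rw [← hQ'.sum_mul i, ← mul_assoc, ← hsum', mul_add, Finset.mul_sum,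
      Finset.sum_eq_zero fun b _ => hιP' (G l) b, add_zero, ← oplusHom_apply, ← hι, ← map_mul,
      hGe, map_zero, zero_mul]
  have hθι : ∀ a : D, θ (ι (oplus a 0)) = oplus a 0 := fun a => by
    ext (x | x | ⟨x, z⟩) (y | y | ⟨y, w⟩) <;> simp [hθ, hι, stageIndexEquiv]
  let R : Fin m → CStarMatrix (Unit ⊕ Fin N) (Unit ⊕ Fin N) D := fun j => oplus 0 (P j)
  have hR : IsOrthogonalProjections R := by
    refine ⟨fun j => (IsStarProjection.zero D).oplus (hP.1 j), fun i j hij => ?_⟩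
    show oplus 0 (P i) * oplus 0 (P j) = 0
    rw [oplus_mul, hP.2 hij, mul_zero, oplus_zero_zero]
  have hsplit : ∀ (a : D) (t : Fin m → ℂ), oplus a (∑ j, t j • P j) = oplus a 0 + ∑ j, t j • R j :=
    fun a t => by
      have : ∑ j, t j • R j = oplus 0 (∑ j, t j • P j) := by
        rw [oplus_zero_sum]
        exact Finset.sum_congr rfl fun j _ => by simp [R, oplus_smul]
      rw [this, oplus_add, add_zero, zero_add]
  refine ⟨Fin N ⊕ κ × (Unit ⊕ Fin N), inferInstance, inferInstance,
    Sum.elim (fun _ => 0) (fun p => (c p.1).succ), Fin m ⊕ β, inferInstance,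
    Sum.elim (fun _ => 0) (fun b => (lev b).succ), Sum.elim ξ ξ',
    fun b => θ (Sum.elim (fun j => ι (R j)) P' b), Fin r ⊕ γ, inferInstance,
    Sum.elim lam ζ, fun i => θ (Sum.elim (fun l => ι (G l)) Q' i), ?_, ?_, ?_, ?_, ?_, ?_, ?_, ?_⟩
  · intro k
    cases k using Fin.cases with
    | zero => exact ⟨Sum.inl ⟨0, hN⟩, rfl⟩
    | succ k =>
      obtain ⟨a, rfl⟩ := hc k
      exact ⟨Sum.inr (a, Sum.inl ()), rfl⟩
  · exact ((hR.map ι).sumElim hP' fun j b => hιP' _ b).map θ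
  · rintro (j | b) x y hxy
    · have hx : ∀ x y, θ (ι (R j)) x y ≠ 0 → ∃ i, x = Sum.inr (Sum.inl i) := by
        rintro (x | x | ⟨x, z⟩) (y | y | ⟨y, w⟩) <;> simp [hθ, hι, stageIndexEquiv, R]
      obtain ⟨i, rfl⟩ := hx _ _ hxy
      -- Self-adjointness turns the statement about rows into the one about columns.
      have hyx : θ (ι (R j)) y (Sum.inr (Sum.inl i)) ≠ 0 := by
        intro h0
        apply hxy
        have h2 : star (θ (ι (R j)) y (Sum.inr (Sum.inl i))) =
            θ (ι (R j)) (Sum.inr (Sum.inl i)) y :=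
          congrFun (congrFun (((hR.map ι).map θ).1 j).isSelfAdjoint.star_eq _) y
        rw [h0, star_zero] at h2
        exact h2.symm
      obtain ⟨i', rfl⟩ := hx _ _ hyx
      exact ⟨rfl, rfl⟩
    · have h1 : P' b (stageIndexEquiv κ (Fin N) x).1 (stageIndexEquiv κ (Fin N) y).1 ≠ 0 := by
        intro h0
        apply hxy
        show P' b (stageIndexEquiv κ (Fin N) x).1 (stageIndexEquiv κ (Fin N) y).1
          (stageIndexEquiv κ (Fin N) x).2 (stageIndexEquiv κ (Fin N) y).2 = 0
        rw [h0]; rfl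
      have h2 : ∀ x, blockIndex c (stageIndexEquiv κ (Fin N) x).1 = some (lev b) →
          blockIndex (Sum.elim (fun _ : Fin N => (0 : Fin (n + 1)))
            (fun p : κ × (Unit ⊕ Fin N) => (c p.1).succ)) x = some (lev b).succ := by
        rintro (x | x | ⟨x, z⟩) h
        · simp [stageIndexEquiv, blockIndex] at h
        · simp [stageIndexEquiv, blockIndex] at h
        · simpa [stageIndexEquiv, blockIndex] using h
      exact ⟨h2 x (hblock _ _ _ h1).1, h2 y (hblock _ _ _ h1).2⟩
  · rintro (j | b) x y
    · show π 0 (θ (ι (R j)) x y) = 0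
      rcases x with x | x | ⟨x, z⟩ <;> rcases y with y | y | ⟨y, w⟩ <;>
        simp [hθ, hι, stageIndexEquiv, R, hPE]
    · exact congrFun (congrFun (hker b (stageIndexEquiv κ (Fin N) x).1
        (stageIndexEquiv κ (Fin N) y).1) (stageIndexEquiv κ (Fin N) x).2)
        (stageIndexEquiv κ (Fin N) y).2
  · rintro (j | b)
    · exact hξ j
    · exact hξ' b
  · exact ((hG.map ι).sumElim hQ' hGQ').map θ
  · rw [← hθι, ← map_sum, ← map_sum, ← map_add, Fintype.sum_sum_type, Fintype.sum_sum_type]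
    congr 1
    have h1 := hsplit E fun _ => 1
    simp only [one_smul] at h1
    simp only [Sum.elim_inl, Sum.elim_inr]
    have h2 : oplus e 0 = ι e := rfl
    rw [← hsum', h2, ← map_sum, ← map_sum, ← add_assoc, ← add_assoc, ← map_add,
      ← map_add, ← h1, ← hsum, add_comm e]
  · intro f hf
    -- The compression by e is subtracted in the first-stage error and added in the second, so it
    -- cancels.
    have h1 : oplus (E * φ f * E) 0 +
        ∑ b, f (Sum.elim ξ ξ' b) • θ (Sum.elim (fun j => ι (R j)) P' b) -
        ∑ i, f (Sum.elim lam ζ i) • θ (Sum.elim (fun l => ι (G l)) Q' i) =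
        θ (ι (oplus (E * φ f * E) (∑ j, f (ξ j) • P j) -
            (e * dilationHom φ x₀ ξ hP f * e + ∑ l, f (lam l) • G l)) +
          (ι (e * dilationHom φ x₀ ξ hP f * e) + ∑ b, f (ξ' b) • P' b -
            ∑ i, f (ζ i) • Q' i)) := by
      rw [← hθι, Fintype.sum_sum_type, Fintype.sum_sum_type, hsplit]
      simp only [Sum.elim_inl, Sum.elim_inr, map_add, map_sub, map_sum, map_smul]
      abel
    rw [h1]
    refine (NonUnitalStarAlgHom.norm_apply_le θ _).trans_lt ?_
    refine (norm_add_le _ _).trans_lt (add_lt_add ?_ (happ' f hf))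
    exact (NonUnitalStarAlgHom.norm_apply_le ι _).trans_lt (happ f hf)

/-- Induction on the length of the chain, for all algebras at once: the hypothesis is applied to
matrices over D, the dilated homomorphism and the leftover projection e. -/
theorem exists_hasDiagonalDilation (x₀ : X) {F : Set C(X, ℂ)} (hF : F.Finite) (n : ℕ) :
    ∀ (K : Fin n → Set X) (_ : ∀ k, IsClosed (K k)) (_ : Monotone K) (_ : ∀ k, x₀ ∈ K k)
      (_ : ∀ k, ConditionD.{u, v} (K k) ((fun f : C(X, ℂ) => f.restrict (K k)) '' F))
      {ε : ℝ} (_ : 0 < ε), ∃ δ : ℝ, 0 < δ ∧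
      ∀ (D : Type u) [CStarAlgebra D] [PartialOrder D] [StarOrderedRing D], HasRealRankZero D →
      ∀ (B : Fin (n + 1) → Type u) [∀ k, CStarAlgebra (B k)] (π : ∀ k, D →⋆ₐ[ℂ] B k),
        (∀ k, Function.Surjective (π k)) → (∀ d, π (Fin.last n) d = 0 → d = 0) →
      ∀ φ : C(X, ℂ) →⋆ₐ[ℂ] D,
        (∀ (k : Fin n) (g : C(X, ℂ)), (∀ x ∈ K k, g x = 0) → π k.succ (φ g) = 0) →
      ∀ E : D, IsStarProjection E → π 0 E = 0 → (∀ f ∈ F, ‖φ f * E - E * φ f‖ < δ) →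
      HasDiagonalDilation K F π φ E ε := by
  induction n with
  | zero =>
    intro K _ _ _ _ ε hε
    refine ⟨1, one_pos, fun D _ _ _ _ B _ π _ hinj φ _ E _ hE0 _ => ?_⟩
    -- For n = 0 the first quotient map is also the last, so E = 0.
    rw [hinj E hE0]
    exact hasDiagonalDilation_zero K F π φ hε
  | succ n ih =>
    intro K hK hKm hx₀ hD ε hε
    obtain ⟨δ', hδ', hih⟩ := ih (fun k => K k.succ) (fun k => hK _)
      (fun i j hij => hKm (Fin.succ_le_succ_iff.2 hij)) (fun k => hx₀ _) (fun k => hD _)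
      (half_pos hε)
    -- The later stages fix δ' first; the first stage must then deliver an e commuting up to δ'.
    obtain ⟨δ, hδ, N, hN, h⟩ := exists_splitting_of_conditionD (hK 0) x₀ hF (hD 0)
      (lt_min hδ' (half_pos hε))
    refine ⟨δ, hδ, fun D _ _ _ hR B _ π hπ hinj φ hφ E hE hE0 hcomm => ?_⟩
    let _ : ∀ k, PartialOrder (B k) := fun k => CStarAlgebra.spectralOrder (B k)
    have : ∀ k, StarOrderedRing (B k) := fun k => CStarAlgebra.spectralOrderedRing (B k)
    obtain ⟨m, r, ξ, lam, P, hP, G, e, hξ, hPE, hG, heG, he, hπe, hsum, hc, ha⟩ :=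
      h D hR (B (Fin.succ 0)) (π (Fin.succ 0)) (hπ _) φ (hφ 0) E hE hcomm
    have hε2 : ε = ε / 2 + ε / 2 := by ring
    rw [hε2]
    refine hasDiagonalDilation_succ (x₀ := x₀) hN hP hξ ?_ hG heG he hsum
      (fun f hf => (ha f hf).trans_le (min_le_right _ _)) ?_
    · intro j x y
      rw [mem_corner_of_mul_scalarDiag (hPE j) x y, map_mul, hE0, mul_zero]
    · refine hih (CStarMatrix (Unit ⊕ Fin N) (Unit ⊕ Fin N) D) hR.cstarMatrix
        (fun k => CStarMatrix (Unit ⊕ Fin N) (Unit ⊕ Fin N) (B k.succ))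
        (fun k => matrixMapHom (Unit ⊕ Fin N) (π k.succ)) (fun k => matrixMapHom_surjective (hπ _))
        (matrixMapHom_injective hinj) _ ?_ e he hπe
        (fun f hf => (hc f hf).trans_le (min_le_left _ _))
      intro k g hg
      -- The points of the first stage and x₀ lie in every later set, so the added summands vanish
      -- on g.
      have h1 : ∀ j, g (ξ j) = 0 := fun j => hg _ (hKm (Fin.zero_le _) (hξ j))
      have h2 : g x₀ = 0 := hg _ (hx₀ _)
      rw [dilationHom_apply, matrixMapHom_oplus, hφ k.succ g hg, h2, evalSumHom_apply]
      simp [h1, oplus_zero_zero]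

end Dilation

/-! ### Passing from a partitioned index set to block diagonal form. -/

section BlockForm

open scoped CStarAlgebra

/-- The embedding `M ↦ 0 ⊕ M 0 ⊕ ⋯ ⊕ M (n - 1)`. -/
def blockHom (A : Type*) [CStarAlgebra A] {n : ℕ} (N : Fin n → ℕ) :
    (∀ k, CStarMatrix (Fin (N k)) (Fin (N k)) A) →⋆ₙₐ[ℂ]
      CStarMatrix (Unit ⊕ Σ k, Fin (N k)) (Unit ⊕ Σ k, Fin (N k)) A where
  toFun M := oplus 0 (bigOplus M)
  map_smul' c M := by
    have : bigOplus (c • M) = c • bigOplus M :=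
      congrArg CStarMatrix.ofMatrix
        (Matrix.blockDiagonal'_smul c fun k => CStarMatrix.ofMatrix.symm (M k))
    simp [this, oplus_smul]
  map_zero' := by
    have : bigOplus (0 : ∀ k, CStarMatrix (Fin (N k)) (Fin (N k)) A) = 0 :=
      congrArg CStarMatrix.ofMatrix Matrix.blockDiagonal'_zero
    rw [this, oplus_zero_zero]
  map_add' M M' := by
    have : bigOplus (M + M') = bigOplus M + bigOplus M' :=
      congrArg CStarMatrix.ofMatrix (Matrix.blockDiagonal'_add
        (fun k => CStarMatrix.ofMatrix.symm (M k)) fun k => CStarMatrix.ofMatrix.symm (M' k))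
    rw [this, oplus_add, add_zero]
  map_mul' M M' := by
    have : bigOplus (M * M') = bigOplus M * bigOplus M' :=
      congrArg CStarMatrix.ofMatrix (Matrix.blockDiagonal'_mul
        (fun k => CStarMatrix.ofMatrix.symm (M k)) fun k => CStarMatrix.ofMatrix.symm (M' k))
    rw [this, oplus_mul, mul_zero]
  map_star' M := by
    have : bigOplus (star M) = star (bigOplus M) :=
      congrArg CStarMatrix.ofMatrix
        (Matrix.blockDiagonal'_conjTranspose fun k => CStarMatrix.ofMatrix.symm (M k)).symm
    rw [this, oplus_star, star_zero]

variable {A : Type*} [CStarAlgebra A] {n : ℕ} {N : Fin n → ℕ}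

theorem blockHom_apply (M : ∀ k, CStarMatrix (Fin (N k)) (Fin (N k)) A) :
    blockHom A N M = oplus 0 (bigOplus M) := rfl

theorem blockHom_same (M : ∀ k, CStarMatrix (Fin (N k)) (Fin (N k)) A) (k : Fin n)
    (x y : Fin (N k)) : blockHom A N M (Sum.inr ⟨k, x⟩) (Sum.inr ⟨k, y⟩) = M k x y :=
  Matrix.blockDiagonal'_apply_eq (fun k => CStarMatrix.ofMatrix.symm (M k)) k x y

theorem blockHom_ne (M : ∀ k, CStarMatrix (Fin (N k)) (Fin (N k)) A) {k k' : Fin n} (hk : k ≠ k')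
    (x : Fin (N k)) (y : Fin (N k')) :
    blockHom A N M (Sum.inr ⟨k, x⟩) (Sum.inr ⟨k', y⟩) = 0 :=
  Matrix.blockDiagonal'_apply_ne (fun k => CStarMatrix.ofMatrix.symm (M k)) x y hk

theorem blockHom_injective : Function.Injective (blockHom A N) := by
  intro M M' h
  funext k
  refine CStarMatrix.ext fun x y => ?_
  exact (blockHom_same M k x y).symm.trans
    ((congrFun (congrFun h _) _).trans (blockHom_same M' k x y))

/-- An enumeration of the domain of a map to `Fin n` by its fibers. -/
theorem exists_sigma_equiv {κ : Type*} [Fintype κ] (c : κ → Fin n) :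
    ∃ (N : Fin n → ℕ) (σ : (Σ k, Fin (N k)) ≃ κ), ∀ s, c (σ s) = s.1 := by
  classical
  refine ⟨fun k => Fintype.card {i // c i = k},
    (Equiv.sigmaCongrRight fun k => (Fintype.equivFin {i // c i = k}).symm).trans
      (Equiv.sigmaFiberEquiv c), fun s => ?_⟩
  exact ((Fintype.equivFin {i // c i = s.1}).symm s.2).2

theorem single_sum_apply {ν : Fin n → ℕ}
    (P : ∀ k, Fin (ν k) → CStarMatrix (Fin (N k)) (Fin (N k)) A) :
    blockHom A N (fun k => ∑ j, P k j) = ∑ k, ∑ j, blockHom A N (Pi.single k (P k j)) := by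
  rw [← Finset.univ_sum_single (fun k => ∑ j, P k j), map_sum]
  refine Finset.sum_congr rfl fun k _ => ?_
  rw [← map_sum]
  congr 1
  exact map_sum (AddMonoidHom.single (fun k => CStarMatrix (Fin (N k)) (Fin (N k)) A) k) _ _

/-- A matrix supported in one block. -/
theorem reindex_eq_blockHom_single {κ : Type*} [Fintype κ] {c : κ → Fin n}
    {σ : (Σ k, Fin (N k)) ≃ κ} (hσ : ∀ s, c (σ s) = s.1) {k : Fin n}
    {M : CStarMatrix (Unit ⊕ κ) (Unit ⊕ κ) A}
    (hM : ∀ x y, M x y ≠ 0 → blockIndex c x = some k ∧ blockIndex c y = some k) :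
    CStarMatrix.reindexₐ ℂ A ((Equiv.refl Unit).sumCongr σ.symm) M =
      blockHom A N (Pi.single k (CStarMatrix.ofMatrix (Matrix.of fun x y =>
        M (Sum.inr (σ ⟨k, x⟩)) (Sum.inr (σ ⟨k, y⟩))))) := by
  have hrow : ∀ x y, blockIndex c x ≠ some k → M x y = 0 := fun x y h => by
    by_contra h0
    exact h (hM x y h0).1
  have hcol : ∀ x y, blockIndex c y ≠ some k → M x y = 0 := fun x y h => by
    by_contra h0
    exact h (hM x y h0).2
  have hidx : ∀ s, blockIndex c (Sum.inr (σ s)) = some s.1 := fun s => congrArg some (hσ s)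
  have hinl : ∀ x : Unit, blockIndex c (Sum.inl x) ≠ some k := fun x => by simp [blockIndex]
  ext (x | ⟨k₁, x⟩) (y | ⟨k₂, y⟩)
  · exact hrow _ _ (hinl x)
  · exact hrow _ _ (hinl x)
  · exact hcol _ _ (hinl y)
  · show M (Sum.inr (σ ⟨k₁, x⟩)) (Sum.inr (σ ⟨k₂, y⟩)) = _
    by_cases h12 : k₁ = k₂
    · subst h12
      rw [blockHom_same]
      by_cases h1 : k₁ = k
      · subst h1
        rw [Pi.single_eq_same]
        rfl
      · rw [Pi.single_eq_of_ne h1]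
        exact hrow _ _ (by rw [hidx]; simpa using h1)
    · rw [blockHom_ne _ h12]
      by_cases h1 : k₁ = k
      · exact hcol _ _ (by rw [hidx]; simpa using fun h2 => h12 (h1.trans h2.symm))
      · exact hrow _ _ (by rw [hidx]; simpa using h1)

theorem CStarMatrix.sum_smul_apply {ι β : Type*} [Fintype β] (t : β → ℂ)
    (M : β → CStarMatrix ι ι A) (x y : ι) : (∑ b, t b • M b) x y = ∑ b, t b • M b x y := by
  classical
  have : ∀ s : Finset β, (∑ b ∈ s, t b • M b) x y = ∑ b ∈ s, t b • M b x y := fun s => by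
    induction s using Finset.induction_on with
    | empty => simp
    | insert a s ha ih => rw [Finset.sum_insert ha, Finset.sum_insert ha, ← ih]; rfl
  exact this _

end BlockForm

/-! ### Assembly of the theorem. -/

theorem lemma4p1 {X : Type v} [MetricSpace X] [CompactSpace X]
    (n : ℕ) (x₀ : X) (K : Fin (n + 1) → Set X)
    (hKclosed : ∀ k, IsClosed (K k)) (hKmono : Monotone K) (hK₀ : K 0 = {x₀})
    (F : Set C(X, ℂ)) (hF : F.Finite)
    (hD : ∀ k : Fin n,
      ConditionD.{u, v} (K k.succ) ((fun f : C(X, ℂ) => f.restrict (K k.succ)) '' F)) :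
    ∀ ε : ℝ, 0 < ε → ∃ δ : ℝ, 0 < δ ∧
      ∀ (A : Type u) [CStarAlgebra A] [PartialOrder A] [StarOrderedRing A],
        HasRealRankZero A →
      ∀ (I : Fin (n + 1) → Ideal A) [∀ k, (I k).IsTwoSided],
        (∀ k, IsClosed (I k : Set A)) → Antitone I → I (Fin.last n) = ⊥ →
      ∀ φ : C(X, ℂ) →⋆ₐ[ℂ] A,
        (∀ (k : Fin n) (g : C(X, ℂ)), (∀ x ∈ K k.succ, g x = 0) →
          Ideal.Quotient.mk (I k.succ) (φ g) = 0) →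
      ∀ p : A, IsStarProjection p →
        Ideal.Quotient.mk (I 0) p = 1 →
        (∀ f ∈ F, ‖φ f * p - p * φ f‖ < δ) →
      ∃ (N : Fin n → ℕ)
        (h : ∀ k, C(X, ℂ) →⋆ₙₐ[ℂ] CStarMatrix (Fin (N k)) (Fin (N k)) A)
        (H : C(X, ℂ) →⋆ₙₐ[ℂ]
          CStarMatrix (Unit ⊕ Σ k, Fin (N k)) (Unit ⊕ Σ k, Fin (N k)) A)
        (L : Fin n → ℕ) (ξ : ∀ k, Fin (L k) → X)
        (P : ∀ k, Fin (L k) → CStarMatrix (Fin (N k)) (Fin (N k)) A)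
        (L' : ℕ) (ζ : Fin L' → X)
        (Q : Fin L' → CStarMatrix (Unit ⊕ Σ k, Fin (N k)) (Unit ⊕ Σ k, Fin (N k)) A),
        (∀ k, 0 < N k) ∧
        -- the homomorphisms `h k`
        (∀ (k : Fin n) (f : C(X, ℂ)),
          h k f ∈ matricesOver (Fin (N k)) (I k.castSucc : Set A)) ∧
        (∀ k, FiniteDimensional ℂ (Submodule.span ℂ (Set.range (h k)))) ∧
        (∀ k, IsOrthogonalProjections (P k)) ∧
        (∀ (k : Fin n) (j : Fin (L k)),
          P k j ∈ matricesOver (Fin (N k)) (I k.castSucc : Set A)) ∧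
        (∀ (k : Fin n) (j : Fin (L k)), ξ k j ∈ K k.succ) ∧
        (∀ (k : Fin n) (f : C(X, ℂ)), h k f = ∑ j, f (ξ k j) • P k j) ∧
        -- the homomorphism `H`
        FiniteDimensional ℂ (Submodule.span ℂ (Set.range H)) ∧
        IsOrthogonalProjections Q ∧
        (∀ f : C(X, ℂ), H f = ∑ i, f (ζ i) • Q i) ∧
        -- the two families of projections have the same sum
        oplus (1 - p) (bigOplus fun k => ∑ j, P k j) = ∑ i, Q i ∧
        -- the approximation
        (∀ f ∈ F,
          ‖oplus ((1 - p) * φ f * (1 - p)) (bigOplus fun k => h k f) - H f‖ < ε) := by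
  intro ε hε
  obtain ⟨δ, hδ, hmain⟩ := exists_hasDiagonalDilation.{u, v} x₀ hF n (fun k => K k.succ)
    (fun k => hKclosed _) (fun i j hij => hKmono (Fin.succ_le_succ_iff.2 hij))
    (fun k => hKmono (Fin.zero_le _) (by rw [hK₀]; rfl)) hD hε
  refine ⟨δ, hδ, ?_⟩
  intro A _ _ _ hA I _ hI _ hIlast φ hφ p hp hp1 hcomm
  choose B iB π hπ hker using fun k => exists_quotient_cstarAlgebra (I k) (hI k)
  obtain ⟨κ, _, _, c, β, _, lev, ξ, P, γ, _, ζ, Q, hc, hP, hblock, hPI, hξ, hQ, hsum, happ⟩ :=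
    hmain A hA B π hπ
      (fun d hd => by
        have := (hker _ d).1 hd
        rwa [hIlast, Ideal.mem_bot] at this)
      φ (fun k g hg => (hker _ _).2 (Ideal.Quotient.eq_zero_iff_mem.1 (hφ k g hg)))
      (1 - p) hp.one_sub
      ((hker _ _).2 (by
        rw [← Ideal.Quotient.eq_zero_iff_mem, map_sub, map_one, hp1, sub_self]))
      (fun f hf => by
        have : φ f * (1 - p) - (1 - p) * φ f = -(φ f * p - p * φ f) := by
          rw [mul_sub, sub_mul, mul_one, one_mul]; abel
        rw [this, norm_neg]
        exact hcomm f hf)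
  have hPI' : ∀ b x y, P b x y ∈ I (lev b).castSucc := fun b x y => (hker _ _).1 (hPI b x y)
  obtain ⟨N, σ, hσ⟩ := exists_sigma_equiv c
  obtain ⟨L, ω, hω⟩ := exists_sigma_equiv lev
  let ρ := CStarMatrix.reindexₐ ℂ A ((Equiv.refl Unit).sumCongr σ.symm)
  let P' : ∀ k, Fin (L k) → CStarMatrix (Fin (N k)) (Fin (N k)) A := fun k j =>
    CStarMatrix.ofMatrix (Matrix.of fun x y =>
      P (ω ⟨k, j⟩) (Sum.inr (σ ⟨k, x⟩)) (Sum.inr (σ ⟨k, y⟩)))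
  have hρP : ∀ k j, ρ (P (ω ⟨k, j⟩)) = blockHom A N (Pi.single k (P' k j)) := fun k j =>
    reindex_eq_blockHom_single hσ fun x y hxy => by
      have := hblock _ x y hxy
      rwa [hω] at this
  -- The block embedding is an injective homomorphism, so the relations are inherited from the
  -- reindexed P.
  have hP' : ∀ k, IsOrthogonalProjections (P' k) := fun k => by
    have hinj : ∀ M M' : CStarMatrix (Fin (N k)) (Fin (N k)) A,
        blockHom A N (Pi.single k M) = blockHom A N (Pi.single k M') → M = M' := fun M M' h =>
      Pi.single_injective k (blockHom_injective h)
    have hρ := hP.map ρ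
    refine ⟨fun j => ⟨hinj _ _ ?_, hinj _ _ ?_⟩, fun i j hij => hinj _ _ ?_⟩
    · rw [Pi.single_mul, map_mul, ← hρP]
      exact (hρ.1 _).isIdempotentElem
    · rw [Pi.single_star, map_star, ← hρP]
      exact (hρ.1 _).isSelfAdjoint
    · rw [Pi.single_mul, map_mul, ← hρP, ← hρP, Pi.single_zero, map_zero]
      exact hρ.2 fun h => hij (by simpa using ω.injective h)
  have hP'I : ∀ (k : Fin n) (j : Fin (L k)),
      P' k j ∈ matricesOver (Fin (N k)) (I k.castSucc : Set A) := fun k j x y => by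
    have := hPI' (ω ⟨k, j⟩) (Sum.inr (σ ⟨k, x⟩)) (Sum.inr (σ ⟨k, y⟩))
    rwa [hω] at this
  -- Used with all coefficients 1 for the equality of sums, and with the values f(ξ) for the
  -- approximation.
  have hassemble : ∀ (a : A) (t : β → ℂ), ρ (oplus a 0 + ∑ b, t b • P b) =
      oplus a (bigOplus fun k => ∑ j, t (ω ⟨k, j⟩) • P' k j) := fun a t => by
    have h1 : ρ (oplus a 0) = oplus a 0 := by
      ext (x | x) (y | y) <;> rfl
    have h2 : ∑ b, t b • ρ (P b) =
        blockHom A N (fun k => ∑ j, t (ω ⟨k, j⟩) • P' k j) := by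
      rw [single_sum_apply, ← ω.sum_comp, Fintype.sum_sigma]
      refine Finset.sum_congr rfl fun k _ => Finset.sum_congr rfl fun j _ => ?_
      rw [hρP, Pi.single_smul, map_smul]
    rw [map_add, h1, map_sum]
    simp only [map_smul]
    rw [h2, blockHom_apply, oplus_add, add_zero, zero_add]
  let g := (Fintype.equivFin γ).symm
  let Q' := fun i => ρ (Q (g i))
  have hQ' : IsOrthogonalProjections Q' :=
    ⟨fun i => (hQ.map ρ).1 _, fun i j hij => (hQ.map ρ).2 fun h => hij (g.injective h)⟩
  refine ⟨N, fun k => evalSumHom (fun j => ξ (ω ⟨k, j⟩)) (hP' k),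
    evalSumHom (fun i => ζ (g i)) hQ', L, fun k j => ξ (ω ⟨k, j⟩), P', Fintype.card γ,
    fun i => ζ (g i), Q', fun k => ?_, fun k f x y => ?_,
    fun k => finiteDimensional_span_range_evalSumHom _ (hP' k), hP', hP'I, fun k j => ?_,
    fun k f => rfl, finiteDimensional_span_range_evalSumHom _ hQ', hQ', fun f => rfl, ?_,
    fun f hf => ?_⟩
  -- Surjectivity of the level map, carried through the induction, makes every block size positive.
  · obtain ⟨i, hi⟩ := hc k
    have h1 := hσ (σ.symm i)
    rw [σ.apply_symm_apply, hi] at h1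
    rw [h1]
    exact Fin.pos (σ.symm i).2
  · rw [evalSumHom_apply, CStarMatrix.sum_smul_apply]
    exact Submodule.sum_mem _ fun j _ => Submodule.smul_of_tower_mem _ _ (hP'I k j x y)
  · have := hξ (ω ⟨k, j⟩)
    rwa [hω] at this
  · have h1 := hassemble (1 - p) fun _ => 1
    simp only [one_smul] at h1
    rw [← h1, hsum, map_sum, ← g.sum_comp]
  · have h1 := hassemble ((1 - p) * φ f * (1 - p)) fun b => f (ξ b)
    have h2 : evalSumHom (fun i => ζ (g i)) hQ' f = ρ (∑ i, f (ζ i) • Q i) := by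
      rw [evalSumHom_apply, map_sum, ← g.sum_comp]
      exact Finset.sum_congr rfl fun i _ => (map_smul ρ _ _).symm
    simp only [evalSumHom_apply] at h2 ⊢
    rw [h2, ← h1, ← map_sub]
    exact (NonUnitalStarAlgHom.norm_apply_le ρ _).trans_lt (happ f hf)
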